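/- For real $q\in L^2[0,1]$ let $L_q=-\frac{d^2}{dx^2}+q$ on $L^2[0,1]$ with Dirichlet boundary conditions at $0$ and $1$, i.e. with domain $\{f\in H^2[0,1]: f(0)=f(1)=0\}$. Its eigenvalues are simple, $\lambda_1(q)<\lambda_2(q)<\dots$; let $\phi_{j,q}$ be the eigenfunction for $\lambda_j(q)$ with $\int_0^1\phi_{j,q}^2\,dx=1$ and $\phi_{j,q}'(0)>0$. The heat content of $L_q$ is $Q_q(t)=\int_0^1u(x;t)\,dx$, $t>0$, where $u$ is the solution of $\partial_tu=-L_qu$ for $t>0$ with Dirichlet boundary conditions and $u(\cdot;t)\to1$ in $L^2[0,1]$ as $t\downarrow0$. Two potentials are isospectral if $\lambda_j(q_1)=\lambda_j(q_2)$ for all $j\ge1$, and isoheat if $Q_{q_1}(t)=Q_{q_2}(t)$ for all $t>0$. Theorem. Let $n\ge1$ be an integer and, for $s\in\mathbb{R}$ and $x\in[0,1]$, let $$\gamma_n(s)(x)=-2\,\partial_x^2\log\theta_n(x;s),\qquad \theta_n(x;s)=1+(e^s-1)\int_x^12\sin^2(n\pi r)\,dr .$$ Then $s\mapsto\gamma_n(s)\in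 L^2[0,1]$ is a solution of the flow $\frac{d}{ds}\gamma_n(s)=X_n(\gamma_n(s))$, $\gamma_n(0)=0$, where $X_n(q)=2\frac{d}{dx}(\phi_{n,q}^2)$; for every $s\in\mathbb{R}$ the potential $\gamma_n(s)$ is isospectral to the zero potential; and $\gamma_n$ is not an isoheat deformation, i.e. the potentials $\gamma_n(s)$, $s\in\mathbb{R}$, are not all isoheat to each other. More precisely, there is $\varepsilon>0$ such that for all $s$ with $0<|s|<\varepsilon$ the potentials $\gamma_n(s)$ and $0$ are not isoheat. -/

import Mathlib

open MeasureTheory Set Filter Topology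

noncomputable section

namespace Isoheat

/-- Lebesgue measure on the unit interval `[0,1]`. -/
abbrev unitMeasure : Measure ℝ := volume.restrict (Icc (0 : ℝ) 1)

/-- The real Hilbert space `L²[0,1]`. -/
abbrev L2 : Type := Lp ℝ 2 unitMeasure

/-- `F` belongs to `H²[0,1]`, with derivative `F'` and weak second derivative `F''` in `L²[0,1]`,
and satisfies the Dirichlet boundary conditions at `0` and `1`. -/
structure IsH2Dirichlet (F F' F'' : ℝ → ℝ) : Prop where
  memLp : MemLp F'' 2 unitMeasure
  fst_deriv : ∀ x ∈ Icc (0 : ℝ) 1, F x = F 0 + ∫ r in (0 : ℝ)..x, F' r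
  snd_deriv : ∀ x ∈ Icc (0 : ℝ) 1, F' x = F' 0 + ∫ r in (0 : ℝ)..x, F'' r
  left : F 0 = 0
  right : F 1 = 0

/-- The graph of the Dirichlet Schrödinger operator `L_q = -d²/dx² + q` in `L²[0,1]`:
`f` lies in the domain of `L_q` and `L_q f = g`. -/
def SchrodingerGraph (q f g : L2) : Prop :=
  ∃ F F' F'' : ℝ → ℝ, IsH2Dirichlet F F' F'' ∧ (∀ᵐ x ∂unitMeasure, f x = F x) ∧
    ∀ᵐ x ∂unitMeasure, g x = -F'' x + q x * F x

/-- `lam` is an eigenvalue of `L_q`. -/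
def IsEigenvalue (q : L2) (lam : ℝ) : Prop :=
  ∃ f : L2, f ≠ 0 ∧ SchrodingerGraph q f (lam • f)

/-- `lam` is the `j`-th eigenvalue `λ_j(q)` of `L_q` in increasing order, `j = 1, 2, …`
(all eigenvalues of `L_q` are simple). -/
def IsNthEigenvalue (q : L2) (j : ℕ) (lam : ℝ) : Prop :=
  IsEigenvalue q lam ∧ {m : ℝ | IsEigenvalue q m ∧ m < lam}.encard + 1 = (j : ℕ∞)

/-- `λ_j(q₁) = λ_j(q₂)` for all `j ≥ 1`. -/
def Isospectral (q₁ q₂ : L2) : Prop :=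
  ∀ j : ℕ, 1 ≤ j → ∀ lam : ℝ, IsNthEigenvalue q₁ j lam ↔ IsNthEigenvalue q₂ j lam

/-- `φ` is the (continuously differentiable representative of the) eigenfunction `φ_{j,q}` for
`λ_j(q)`, with derivative `φ'`, normalized by `∫ φ² = 1` and `φ'(0) > 0`. -/
def IsNthEigenfunction (q : L2) (j : ℕ) (φ φ' : ℝ → ℝ) : Prop :=
  ∃ (lam : ℝ) (φ'' : ℝ → ℝ), IsNthEigenvalue q j lam ∧ IsH2Dirichlet φ φ' φ'' ∧
    (∀ᵐ x ∂unitMeasure, -φ'' x + q x * φ x = lam * φ x) ∧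
    (∫ x in (0 : ℝ)..1, φ x ^ 2) = 1 ∧ 0 < φ' 0

/-- `v = X_n(q) = 2 (d/dx) (φ_{n,q})²` in `L²[0,1]`. -/
def IsVectorFieldValue (n : ℕ) (q v : L2) : Prop :=
  ∃ φ φ' : ℝ → ℝ, IsNthEigenfunction q n φ φ' ∧
    ∀ᵐ x ∂unitMeasure, v x = 2 * deriv (fun y => φ y ^ 2) x

/-- `s ↦ γ s` solves `γ'(s) = X_n(γ(s))` in `L²[0,1]` for all real `s`, with `γ(0) = q₀`. -/
def IsFlowLine (n : ℕ) (q₀ : L2) (γ : ℝ → L2) : Prop :=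
  γ 0 = q₀ ∧ ∀ s : ℝ, ∃ v : L2, IsVectorFieldValue n (γ s) v ∧ HasDerivAt γ v s

/-- `u` solves `∂u/∂t = -L_q u` for `t > 0`, with Dirichlet boundary conditions and with
`u(·;t) → 1` in `L²[0,1]` as `t ↓ 0`. -/
def IsHeatSolution (q : L2) (u : ℝ → L2) : Prop :=
  (∀ t : ℝ, 0 < t → ∃ v : L2, SchrodingerGraph q (u t) v ∧ HasDerivAt u (-v) t) ∧
    Tendsto u (𝓝[>] 0) (𝓝 (Lp.const 2 unitMeasure (1 : ℝ)))

open Classical in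
/-- The heat content `Q_q(t) = ∫₀¹ u(x;t) dx`, where `u` is the solution, unique for `t > 0`, of
the heat equation of `L_q` with initial value `1`. -/
def heatContent (q : L2) (t : ℝ) : ℝ :=
  if h : ∃ u : ℝ → L2, IsHeatSolution q u then ∫ x, (h.choose t) x ∂unitMeasure else 0

/-- `Q_{q₁}(t) = Q_{q₂}(t)` for all `t > 0`. -/
def IsIsoheat (q₁ q₂ : L2) : Prop :=
  ∀ t : ℝ, 0 < t → heatContent q₁ t = heatContent q₂ t

/-- The potentials `γ s` are isoheat to each other. -/
def IsIsoheatDeformation (γ : ℝ → L2) : Prop :=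
  ∀ s s' : ℝ, IsIsoheat (γ s) (γ s')

/-- `θ_n(x;s) = 1 + (e^s - 1) ∫_x^1 2 sin²(nπr) dr`. -/
def theta (n : ℕ) (s x : ℝ) : ℝ :=
  1 + (Real.exp s - 1) * ∫ r in x..(1 : ℝ), 2 * Real.sin (n * Real.pi * r) ^ 2

/-- `γ_n(x;s) = -2 ∂_x² log θ_n(x;s)`. -/
def gammaFun (n : ℕ) (s x : ℝ) : ℝ :=
  -2 * iteratedDeriv 2 (fun y => Real.log (theta n s y)) x

theorem contDiff_theta (n : ℕ) (s : ℝ) : ContDiff ℝ 2 (theta n s) := by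
  have key : ∃ g : ℝ → ℝ, ContDiff ℝ 2 g ∧
      ∀ x, ∫ r in x..(1 : ℝ), 2 * Real.sin (n * Real.pi * r) ^ 2 = g x := by
    rcases Nat.eq_zero_or_pos n with rfl | hn
    · exact ⟨fun _ => 0, contDiff_const, fun x => by simp⟩
    · have hc : (n * Real.pi : ℝ) ≠ 0 := by positivity
      set c : ℝ := n * Real.pi
      refine ⟨fun x => 2 * (c⁻¹ * ((Real.sin (c * x) * Real.cos (c * x)
        - Real.sin (c * 1) * Real.cos (c * 1) + c * 1 - c * x) / 2)), by fun_prop, fun x => ?_⟩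
      rw [intervalIntegral.integral_const_mul,
        intervalIntegral.integral_comp_mul_left (fun y => Real.sin y ^ 2) hc, integral_sin_sq,
        smul_eq_mul]
  obtain ⟨g, hg, h⟩ := key
  have : theta n s = fun x => 1 + (Real.exp s - 1) * g x := by
    funext x
    simp only [theta, h]
  rw [this]
  fun_prop

theorem theta_pos (n : ℕ) (s : ℝ) {x : ℝ} (hx : x ∈ Icc (0 : ℝ) 1) : 0 < theta n s x := by
  have hint : ∀ a b : ℝ, IntervalIntegrable (fun r => 2 * Real.sin (n * Real.pi * r) ^ 2)
      volume a b := fun a b => Continuous.intervalIntegrable (by fun_prop) a b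
  have h0 : 0 ≤ ∫ r in x..(1 : ℝ), 2 * Real.sin (n * Real.pi * r) ^ 2 :=
    intervalIntegral.integral_nonneg hx.2 fun r _ => by positivity
  have h0' : 0 ≤ ∫ r in (0 : ℝ)..x, 2 * Real.sin (n * Real.pi * r) ^ 2 :=
    intervalIntegral.integral_nonneg hx.1 fun r _ => by positivity
  have hadd := intervalIntegral.integral_add_adjacent_intervals (hint 0 x) (hint x 1)
  have htot : ∫ r in (0 : ℝ)..1, 2 * Real.sin (n * Real.pi * r) ^ 2 ≤ 1 := by
    rcases Nat.eq_zero_or_pos n with rfl | hn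
    · simp
    · have hc : (n * Real.pi : ℝ) ≠ 0 := by positivity
      rw [intervalIntegral.integral_const_mul,
        intervalIntegral.integral_comp_mul_left (fun y => Real.sin y ^ 2) hc, integral_sin_sq]
      simp [Real.sin_nat_mul_pi]
      field_simp
      exact le_refl _
  have h1 : ∫ r in x..(1 : ℝ), 2 * Real.sin (n * Real.pi * r) ^ 2 ≤ 1 := by linarith
  have he := Real.exp_pos s
  rw [theta]
  set b := ∫ r in x..(1 : ℝ), 2 * Real.sin (n * Real.pi * r) ^ 2
  by_cases hb : b = 0
  · simp [hb]
  · have : 0 < b := lt_of_le_of_ne h0 (Ne.symm hb)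
    nlinarith [mul_pos he this]

theorem memLp_gammaFun (n : ℕ) (s : ℝ) : MemLp (gammaFun n s) 2 unitMeasure := by
  have hU : IsOpen {x : ℝ | 0 < theta n s x} :=
    isOpen_lt continuous_const (contDiff_theta n s).continuous
  have hsub : Icc (0 : ℝ) 1 ⊆ {x : ℝ | 0 < theta n s x} := fun x hx => theta_pos n s hx
  have hc : ContDiffOn ℝ 2 (fun y => Real.log (theta n s y)) {x : ℝ | 0 < theta n s x} :=
    (contDiff_theta n s).contDiffOn.log fun x hx => ne_of_gt hx
  have h2 : ContinuousOn (iteratedDeriv 2 fun y => Real.log (theta n s y)) (Icc (0 : ℝ) 1) := by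
    have h := hc.continuousOn_iteratedDerivWithin (m := 2) le_rfl hU.uniqueDiffOn
    exact (h.congr fun x hx => (iteratedDerivWithin_of_isOpen hU hx).symm).mono hsub
  have h3 : ContinuousOn (gammaFun n s) (Icc (0 : ℝ) 1) := continuousOn_const.mul h2
  obtain ⟨C, hC⟩ := isCompact_Icc.exists_bound_of_continuousOn h3
  exact MemLp.of_bound (h3.aestronglyMeasurable measurableSet_Icc) C
    ((ae_restrict_iff' measurableSet_Icc).2 (Eventually.of_forall hC))

/-- The curve `s ↦ γ_n(s)` in `L²[0,1]`. -/
def gammaFlow (n : ℕ) (s : ℝ) : L2 := (memLp_gammaFun n s).toLp (gammaFun n s)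

end Isoheat

end

/-! With `c = exp s - 1` and `φ` the `n`-th Dirichlet eigenfunction of the zero potential,
`γ_n(s)` is `-2 (log τ)''` for `τ = 1 + c ∫ₓ¹ φ²`. The double commutation
`ψ ↦ ψ - c (φ / τ) ∫ₓ¹ φ ψ` carries the eigenfunctions of the zero potential to those of `γ_n(s)`
at the same eigenvalues, and preserves orthogonality and completeness; in particular the spectrum
is unchanged. The `n`-th normalized eigenfunction of `γ_n(s)` is `√(1 + c) φ / τ`, and
differentiating `-2 (log τ)''` in `s` gives twice the derivative of its square, which is the flow
equation.

Expanding the constant function `1` in an orthonormal eigenbasis gives the heat content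
`∑ e^{-λ_j t} (∫ φ_j)²`. Dirichlet series determine their coefficients, so isoheat isospectral
potentials have the same squared means `(∫ φ_j)²`. For the zero potential the mean at `j = 2n`
vanishes, whereas for `γ_n(s)` it is `c` times a positive number, since
`∫ₓ¹ sin(nπr) sin(2nπr) dr` is a negative multiple of `sin³(nπx)`. -/

noncomputable section

namespace Isoheat

section Interval

variable {a b : ℝ}

theorem integral_deriv_mul_add_mul_deriv_of_eq_add_integral (hab : a ≤ b) {p P g G : ℝ → ℝ}
    (hp : IntervalIntegrable p volume a b) (hP : ∀ x ∈ Icc a b, P x = P a + ∫ r in a..x, p r)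
    (hg : IntervalIntegrable g volume a b) (hG : ∀ x ∈ Icc a b, G x = G a + ∫ r in a..x, g r) :
    ∫ x in a..b, (p x * G x + P x * g x) = P b * G b - P a * G a := by
  have absCont : ∀ {p : ℝ → ℝ} (c : ℝ), IntervalIntegrable p volume a b →
      AbsolutelyContinuousOnInterval (fun x => c + ∫ r in a..x, p r) a b := fun c hp =>
    .fun_add contDiff_const.contDiffOn.absolutelyContinuousOnInterval
      (hp.absolutelyContinuousOnInterval_intervalIntegral left_mem_uIcc)
  have h := (absCont (P a) hp).integral_deriv_mul_eq_sub (absCont (G a) hg)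
  rw [← hP b (right_mem_Icc.2 hab), ← hG b (right_mem_Icc.2 hab),
    ← hP a (left_mem_Icc.2 hab), ← hG a (left_mem_Icc.2 hab)] at h
  rw [← h]
  refine intervalIntegral.integral_congr_ae ?_
  filter_upwards [hp.ae_hasDerivAt_integral, hg.ae_hasDerivAt_integral] with x hpx hgx hx
  have hx' := uIoc_subset_uIcc hx
  have hxI : x ∈ Icc a b := by rwa [uIcc_of_le hab] at hx'
  rw [((hpx hx' a left_mem_uIcc).const_add (P a)).deriv,
    ((hgx hx' a left_mem_uIcc).const_add (G a)).deriv, hP x hxI, hG x hxI]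

theorem continuousOn_of_eq_add_integral (hab : a ≤ b) {p P : ℝ → ℝ}
    (hp : IntervalIntegrable p volume a b) (hP : ∀ x ∈ Icc a b, P x = P a + ∫ r in a..x, p r) :
    ContinuousOn P (Icc a b) := by
  have h := intervalIntegral.continuousOn_primitive_interval' hp left_mem_uIcc
  rw [uIcc_of_le hab] at h
  exact (continuousOn_const.add h).congr hP

theorem eq_add_integral_of_hasDerivWithinAt {g g' : ℝ → ℝ}
    (hg : ∀ x ∈ Icc a b, HasDerivWithinAt g (g' x) (Icc a b) x)
    (hg' : ContinuousOn g' (Icc a b)) :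
    ∀ x ∈ Icc a b, g x = g a + ∫ r in a..x, g' r := by
  intro x hx
  have hsub : Icc a x ⊆ Icc a b := Icc_subset_Icc_right hx.2
  rw [intervalIntegral.integral_eq_sub_of_hasDerivAt_of_le hx.1
    (fun y hy => (hg y (hsub hy)).continuousWithinAt.mono hsub)
    (fun y hy => (hg y (hsub (Ioo_subset_Icc_self hy))).hasDerivAt
      (Icc_mem_nhds hy.1 (hy.2.trans_le hx.2)))
    ((hg'.mono hsub).intervalIntegrable_of_Icc hx.1)]
  ring

theorem hasDerivWithinAt_integral_left_endpoint {p : ℝ → ℝ}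
    (hp : ContinuousOn p (Icc a b)) {x : ℝ} (hx : x ∈ Icc a b) :
    HasDerivWithinAt (fun y => ∫ r in y..b, p r) (-p x) (Icc a b) x := by
  have : Fact (x ∈ Icc a b) := ⟨hx⟩
  exact intervalIntegral.integral_hasDerivWithinAt_left
    ((hp.mono (Icc_subset_Icc_left hx.1)).intervalIntegrable_of_Icc hx.2)
    (hp.stronglyMeasurableAtFilter_nhdsWithin measurableSet_Icc x) (hp x hx)

theorem hasDerivWithinAt_integral_right_endpoint {p : ℝ → ℝ}
    (hp : ContinuousOn p (Icc a b)) {x : ℝ} (hx : x ∈ Icc a b) :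
    HasDerivWithinAt (fun y => ∫ r in a..y, p r) (p x) (Icc a b) x := by
  have : Fact (x ∈ Icc a b) := ⟨hx⟩
  exact intervalIntegral.integral_hasDerivWithinAt_right
    ((hp.mono (Icc_subset_Icc_right hx.2)).intervalIntegrable_of_Icc hx.1)
    (hp.stronglyMeasurableAtFilter_nhdsWithin measurableSet_Icc x) (hp x hx)

end Interval

section UnitMeasure

theorem integral_unitMeasure (f : ℝ → ℝ) :
    ∫ x, f x ∂unitMeasure = ∫ x in (0 : ℝ)..1, f x := by
  rw [intervalIntegral.integral_of_le zero_le_one, integral_Icc_eq_integral_Ioc]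

theorem integrable_unitMeasure_iff {f : ℝ → ℝ} :
    Integrable f unitMeasure ↔ IntervalIntegrable f volume 0 1 := by
  rw [intervalIntegrable_iff_integrableOn_Icc_of_le zero_le_one, IntegrableOn]

theorem ae_unitMeasure_of_forall_mem_Ioo {p : ℝ → Prop} (h : ∀ x ∈ Ioo (0 : ℝ) 1, p x) :
    ∀ᵐ x ∂unitMeasure, p x := by
  rw [unitMeasure, ← restrict_Ioo_eq_restrict_Icc]
  exact ae_restrict_of_forall_mem measurableSet_Ioo h

theorem integral_congr_of_ae_unitMeasure {f g : ℝ → ℝ} (h : f =ᵐ[unitMeasure] g)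
    {x : ℝ} (hx : x ∈ Icc (0 : ℝ) 1) : ∫ r in (0 : ℝ)..x, f r = ∫ r in (0 : ℝ)..x, g r := by
  refine intervalIntegral.integral_congr_ae ?_
  filter_upwards [(ae_restrict_iff' measurableSet_Icc).1 h] with y hy hyx
  rw [uIoc_of_le hx.1] at hyx
  exact hy ⟨hyx.1.le, hyx.2.trans hx.2⟩

theorem memLp_unitMeasure_of_continuousOn {p : ENNReal} {f : ℝ → ℝ}
    (hf : ContinuousOn f (Icc 0 1)) : MemLp f p unitMeasure := by
  obtain ⟨C, hC⟩ := isCompact_Icc.exists_bound_of_continuousOn hf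
  exact MemLp.of_bound (hf.aestronglyMeasurable measurableSet_Icc) C
    (ae_restrict_of_forall_mem measurableSet_Icc hC)

theorem intervalIntegrable_of_memLp_unitMeasure {f : ℝ → ℝ} (hf : MemLp f 2 unitMeasure) :
    IntervalIntegrable f volume 0 1 :=
  integrable_unitMeasure_iff.1 (hf.integrable one_le_two)

theorem inner_eq_integral (f g : L2) : inner ℝ f g = ∫ x, g x * f x ∂unitMeasure := by
  simp only [L2.inner_def, RCLike.inner_apply, conj_trivial]

end UnitMeasure

section Moments

open Polynomial

theorem exists_polynomial_comp_near {X : Type*} [TopologicalSpace X] {K : Set X}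
    (hK : IsCompact K) {φ G : X → ℝ} (hφ : ContinuousOn φ K) (hinj : InjOn φ K)
    (hG : ContinuousOn G K) {ε : ℝ} (hε : 0 < ε) :
    ∃ p : ℝ[X], ∀ x ∈ K, |p.eval (φ x) - G x| < ε := by
  have : CompactSpace K := isCompact_iff_compactSpace.1 hK
  let φK : C(K, ℝ) := ⟨K.domRestrict φ, hφ.domRestrict⟩
  have separates : (Algebra.adjoin ℝ {φK}).SeparatesPoints := fun x y hxy =>
    ⟨φK, ⟨φK, Algebra.self_mem_adjoin_singleton ℝ φK, rfl⟩,
      fun h => hxy (Subtype.ext (hinj x.2 y.2 h))⟩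
  obtain ⟨⟨f, hf⟩, hfG⟩ := ContinuousMap.exists_mem_subalgebra_near_continuous_of_separatesPoints
    _ separates (K.domRestrict G) hG.domRestrict ε hε
  rw [Algebra.adjoin_singleton_eq_range_aeval] at hf
  obtain ⟨p, rfl⟩ := hf
  refine ⟨p, fun x hx => ?_⟩
  have h : |aeval φK p ⟨x, hx⟩ - G x| < ε := hfG ⟨x, hx⟩
  rwa [aeval_continuousMap_apply] at h

variable {E : Type*} [NormedAddCommGroup E] [MeasurableSpace E] [BorelSpace E]
  {μ : Measure E} {K : Set E} {g φ : E → ℝ}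

theorem integral_mul_polynomial_comp_eq_zero (hK : IsCompact K) (hg : IntegrableOn g K μ)
    (hφ : ContinuousOn φ K) (hmoment : ∀ k : ℕ, ∫ x in K, g x * φ x ^ k ∂μ = 0) (p : ℝ[X]) :
    ∫ x in K, g x * p.eval (φ x) ∂μ = 0 := by
  have integrable : ∀ q : ℝ[X], IntegrableOn (fun x => g x * q.eval (φ x)) K μ := fun q =>
    hg.mul_continuousOn (q.continuous.comp_continuousOn hφ) hK
  induction p using Polynomial.induction_on' with
  | add p q hp hq =>
    simp only [eval_add, mul_add]
    rw [integral_add (integrable p) (integrable q), hp, hq, add_zero]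
  | monomial k c =>
    simp only [eval_monomial, mul_left_comm _ c]
    rw [integral_const_mul, hmoment, mul_zero]

theorem integral_mul_eq_zero_of_moments (hK : IsCompact K) (hg : IntegrableOn g K μ)
    (hφ : ContinuousOn φ K) (hinj : InjOn φ K)
    (hmoment : ∀ k : ℕ, ∫ x in K, g x * φ x ^ k ∂μ = 0) {G : E → ℝ} (hG : ContinuousOn G K) :
    ∫ x in K, g x * G x ∂μ = 0 := by
  set M := ∫ x in K, |g x| ∂μ
  have : 0 ≤ M := integral_nonneg fun x => abs_nonneg _
  have near : ∀ ε > 0, |∫ x in K, g x * G x ∂μ| ≤ ε * M := by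
    intro ε hε
    obtain ⟨p, hp⟩ := exists_polynomial_comp_near hK hφ hinj hG hε
    have hpφ : ContinuousOn (fun x => p.eval (φ x)) K := p.continuous.comp_continuousOn hφ
    calc |∫ x in K, g x * G x ∂μ|
        = |∫ x in K, g x * (p.eval (φ x) - G x) ∂μ| := by
          simp only [mul_sub]
          rw [integral_sub (hg.mul_continuousOn hpφ hK) (hg.mul_continuousOn hG hK),
            integral_mul_polynomial_comp_eq_zero hK hg hφ hmoment p, zero_sub, abs_neg]
      _ ≤ ∫ x in K, |g x * (p.eval (φ x) - G x)| ∂μ := abs_integral_le_integral_abs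
      _ ≤ ∫ x in K, ε * |g x| ∂μ := by
          refine setIntegral_mono_on (hg.mul_continuousOn (hpφ.sub hG) hK).abs
            (hg.abs.const_mul ε) hK.measurableSet fun x hx => ?_
          rw [abs_mul, mul_comm]
          exact mul_le_mul_of_nonneg_right (hp x hx).le (abs_nonneg _)
      _ = ε * M := integral_const_mul ε _
  refine abs_nonpos_iff.1 (le_of_forall_pos_le_add fun δ hδ => ?_)
  calc |∫ x in K, g x * G x ∂μ| ≤ δ / (M + 1) * M := near _ (by positivity)
    _ ≤ 0 + δ := by
      rw [div_mul_eq_mul_div, div_le_iff₀ (by positivity)]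
      nlinarith

theorem ae_eq_zero_of_moments [NormedSpace ℝ E] [FiniteDimensional ℝ E] (hK : IsCompact K)
    (hg : IntegrableOn g K μ) (hφ : ContinuousOn φ K) (hinj : InjOn φ K)
    (hmoment : ∀ k : ℕ, ∫ x in K, g x * φ x ^ k ∂μ = 0) : ∀ᵐ x ∂μ.restrict K, g x = 0 := by
  refine ae_eq_zero_of_integral_contDiff_smul_eq_zero hg.locallyIntegrable fun G hG _ => ?_
  simpa only [smul_eq_mul, mul_comm] using
    integral_mul_eq_zero_of_moments hK hg hφ hinj hmoment hG.continuous.continuousOn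

end Moments

section SineCompleteness

open Real

variable {h : ℝ → ℝ}

theorem integral_mul_sin_mul_cos_pow_eq_zero (hh : IntervalIntegrable h volume 0 1)
    (horth : ∀ k : ℕ, ∫ x in (0 : ℝ)..1, h x * sin (k * π * x) = 0) (m : ℕ) (k : ℤ) :
    ∫ x in (0 : ℝ)..1, h x * sin (k * π * x) * cos (π * x) ^ m = 0 := by
  induction m generalizing k with
  | zero =>
    obtain ⟨k, rfl | rfl⟩ := k.eq_nat_or_neg
    · simpa using horth k
    · simpa [neg_mul, sin_neg] using horth k
  | succ m ih =>
    have integrable : ∀ k : ℤ,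
        IntervalIntegrable (fun x => h x * sin (k * π * x) * cos (π * x) ^ m) volume 0 1 := fun k =>
      (hh.mul_continuousOn (by fun_prop)).mul_continuousOn (by fun_prop)
    have product_to_sum : ∀ x, h x * sin (k * π * x) * cos (π * x) ^ (m + 1) =
        2⁻¹ * (h x * sin ((k + 1 : ℤ) * π * x) * cos (π * x) ^ m +
          h x * sin ((k - 1 : ℤ) * π * x) * cos (π * x) ^ m) := by
      intro x
      have e₁ : ((k + 1 : ℤ) : ℝ) * π * x = k * π * x + π * x := by push_cast; ring
      have e₂ : ((k - 1 : ℤ) : ℝ) * π * x = k * π * x - π * x := by push_cast; ring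
      rw [e₁, e₂, sin_add, sin_sub]
      ring
    simp only [product_to_sum]
    rw [intervalIntegral.integral_const_mul,
      intervalIntegral.integral_add (integrable _) (integrable _), ih, ih, add_zero, mul_zero]

theorem ae_eq_zero_of_integral_mul_sin_eq_zero (hh : IntervalIntegrable h volume 0 1)
    (horth : ∀ k : ℕ, ∫ x in (0 : ℝ)..1, h x * sin (k * π * x) = 0) :
    h =ᵐ[unitMeasure] 0 := by
  have injOn_cos : InjOn (fun x => cos (π * x)) (Icc 0 1) := fun x hx y hy hxy =>
    mul_left_cancel₀ pi_ne_zero (injOn_cos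
      ⟨by have := hx.1; positivity, mul_le_of_le_one_right pi_nonneg hx.2⟩
      ⟨by have := hy.1; positivity, mul_le_of_le_one_right pi_nonneg hy.2⟩ hxy)
  have mul_sin_eq_zero : ∀ᵐ x ∂unitMeasure, h x * sin (π * x) = 0 := by
    refine ae_eq_zero_of_moments isCompact_Icc (φ := fun x => cos (π * x))
      (integrable_unitMeasure_iff.2 (hh.mul_continuousOn (by fun_prop)))
      (by fun_prop) injOn_cos fun m => ?_
    rw [integral_unitMeasure]
    simpa using integral_mul_sin_mul_cos_pow_eq_zero hh horth m 1
  have sin_ne_zero : ∀ᵐ x ∂unitMeasure, sin (π * x) ≠ 0 :=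
    ae_unitMeasure_of_forall_mem_Ioo fun x hx => (sin_pos_of_pos_of_lt_pi
      (mul_pos pi_pos hx.1) (mul_lt_of_lt_one_right pi_pos hx.2)).ne'
  filter_upwards [mul_sin_eq_zero, sin_ne_zero] with x hx hx'
  exact (mul_eq_zero.1 hx).resolve_right hx'

end SineCompleteness

section DirichletSeries

open Real

theorem eq_zero_of_tsum_exp_mul_eq_zero {lam d : ℕ → ℝ} (hlam : StrictMono lam)
    (hd : Summable fun j => |d j|)
    (h : ∀ t : ℝ, 0 < t → ∑' j, exp (-lam j * t) * d j = 0) (j : ℕ) : d j = 0 := by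
  induction j using Nat.strong_induction_on with
  | _ m ih =>
    have rescaled_eq_zero : ∀ t : ℝ, 0 < t → ∑' j, exp (-(lam j - lam m) * t) * d j = 0 := by
      intro t ht
      calc ∑' j, exp (-(lam j - lam m) * t) * d j
          = ∑' j, exp (lam m * t) * (exp (-lam j * t) * d j) := by
            refine tsum_congr fun j => ?_
            rw [← mul_assoc, ← exp_add]
            ring_nf
        _ = 0 := by rw [tsum_mul_left, h t ht, mul_zero]
    have tendsto_coeff : Tendsto (fun t => ∑' j, exp (-(lam j - lam m) * t) * d j) atTop
        (𝓝 (∑' j, if j = m then d m else 0)) := by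
      refine tendsto_tsum_of_dominated_convergence hd (fun j => ?_) ?_
      · rcases lt_trichotomy j m with hj | rfl | hj
        · simp [ih j hj, hj.ne]
        · simp
        · rw [if_neg hj.ne', ← zero_mul (d j)]
          exact (tendsto_exp_atBot.comp (tendsto_id.const_mul_atTop_of_neg
            (by linarith [hlam hj]))).mul_const _
      · filter_upwards [eventually_gt_atTop 0] with t ht j
        rcases lt_or_ge j m with hj | hj
        · simp [ih j hj]
        · rw [norm_mul, norm_eq_abs, norm_eq_abs, abs_of_pos (exp_pos _)]
          refine mul_le_of_le_one_left (abs_nonneg _) (exp_le_one_iff.2 ?_)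
          nlinarith [hlam.monotone hj]
    rw [tsum_ite_eq] at tendsto_coeff
    refine tendsto_nhds_unique tendsto_coeff (tendsto_const_nhds.congr' ?_)
    filter_upwards [eventually_gt_atTop 0] with t ht
    exact (rescaled_eq_zero t ht).symm

theorem eq_exp_mul_of_hasDerivAt {l c : ℝ} {y : ℝ → ℝ}
    (hy : ∀ t, 0 < t → HasDerivAt y (-l * y t) t) (hlim : Tendsto y (𝓝[>] 0) (𝓝 c))
    {t : ℝ} (ht : 0 < t) : y t = exp (-l * t) * c := by
  set z : ℝ → ℝ := fun s => exp (l * s) * y s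
  have hz : ∀ s, 0 < s → HasDerivAt z 0 s := fun s hs => by
    convert! (((hasDerivAt_id s).const_mul l).exp).mul (hy s hs) using 1
    simp only [id_eq, mul_one]
    ring
  have const : ∀ s, 0 < s → z s = z t := fun s hs =>
    isOpen_Ioi.is_const_of_deriv_eq_zero isPreconnected_Ioi
      (fun r hr => (hz r hr).differentiableAt.differentiableWithinAt)
      (fun r hr => (hz r hr).deriv) hs ht
  have lim : Tendsto z (𝓝[>] 0) (𝓝 c) := by
    have hexp : Tendsto (fun s => exp (l * s)) (𝓝[>] 0) (𝓝 1) := by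
      have : Continuous fun s => exp (l * s) := by fun_prop
      simpa using (this.tendsto 0).mono_left nhdsWithin_le_nhds
    simpa using hexp.mul hlim
  have hzt : z t = c := by
    refine tendsto_nhds_unique (tendsto_const_nhds.congr' ?_) lim
    exact eventually_nhdsWithin_of_forall fun s hs => (const s hs).symm
  rw [← hzt, ← mul_assoc, ← exp_add]
  simp

end DirichletSeries

section HeatFlow

open Real

variable {ι H : Type*} [NormedAddCommGroup H] [InnerProductSpace ℝ H]

/-- The heat semigroup of the operator with eigenvalue `lam j` on the basis vector `b j`, applied to
the initial value `h`. -/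
def heatFlow (b : HilbertBasis ι ℝ H) (lam : ι → ℝ) (h : H) (t : ℝ) : H :=
  ∑' j, (exp (-lam j * t) * inner ℝ (b j) h) • b j

variable {b : HilbertBasis ι ℝ H} {lam : ι → ℝ}

theorem inner_eq_of_hasSum_smul_basis {c : ι → ℝ} {x : H} (hx : HasSum (fun j => c j • b j) x)
    (j : ι) : inner ℝ (b j) x = c j := by
  have h : HasSum (fun i => inner ℝ (b j) (c i • b i)) (inner ℝ (b j) x) :=
    hx.mapL (innerSL ℝ (b j))
  rw [h.unique (hasSum_single j fun i hij => by
      rw [inner_smul_right, b.orthonormal.2 hij.symm, mul_zero]),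
    inner_smul_right, real_inner_self_eq_norm_sq, b.orthonormal.1 j, one_pow, mul_one]

theorem ext_inner_basis {x y : H} (h : ∀ j, inner ℝ (b j) x = inner ℝ (b j) y) : x = y :=
  b.repr.injective (lp.ext (funext fun j => by simpa only [b.repr_apply_apply] using h j))

theorem norm_sq_eq_tsum_inner_sq (b : HilbertBasis ι ℝ H) (x : H) :
    ‖x‖ ^ 2 = ∑' j, inner ℝ (b j) x ^ 2 := by
  rw [← real_inner_self_eq_norm_sq, ← b.tsum_inner_mul_inner x x]
  exact tsum_congr fun j => by rw [real_inner_comm, sq]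

theorem summable_inner_sq (b : HilbertBasis ι ℝ H) (x : H) :
    Summable fun j => inner ℝ (b j) x ^ 2 :=
  (b.summable_inner_mul_inner x x).congr fun j => by rw [real_inner_comm, sq]

theorem norm_mul_inner_smul_basis_le (b : HilbertBasis ι ℝ H) (c : ℝ) (h : H) (j : ι) :
    ‖(c * inner ℝ (b j) h) • b j‖ ≤ |c| * ‖h‖ := by
  rw [norm_smul, b.orthonormal.1 j, mul_one, norm_mul, norm_eq_abs]
  gcongr
  simpa [b.orthonormal.1 j] using norm_inner_le_norm (𝕜 := ℝ) (b j) h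

theorem summable_mul_inner_smul_basis [CompleteSpace H] {c : ι → ℝ} (hc : Summable c) (h : H) :
    Summable fun j => (c j * inner ℝ (b j) h) • b j :=
  .of_norm_bounded (hc.abs.mul_right ‖h‖) fun j => norm_mul_inner_smul_basis_le b (c j) h j

theorem summable_mul_exp (hlam : ∀ j, 0 ≤ lam j)
    (hexp : ∀ t : ℝ, 0 < t → Summable fun j => exp (-lam j * t)) {t : ℝ} (ht : 0 < t) :
    Summable fun j => lam j * exp (-lam j * t) := by
  refine ((hexp (t / 2) (half_pos ht)).mul_left (2 / t)).of_nonneg_of_le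
    (fun j => mul_nonneg (hlam j) (exp_pos _).le) fun j => ?_
  have split : exp (-lam j * (t / 2)) = exp (lam j * t / 2) * exp (-lam j * t) := by
    rw [← exp_add]
    ring_nf
  rw [split, ← mul_assoc]
  gcongr
  calc lam j = 2 / t * (lam j * t / 2) := by field_simp
    _ ≤ 2 / t * exp (lam j * t / 2) := by
      gcongr
      linarith [add_one_le_exp (lam j * t / 2)]

theorem hasSum_heatFlow [CompleteSpace H]
    (hexp : ∀ t : ℝ, 0 < t → Summable fun j => exp (-lam j * t)) (h : H) {t : ℝ} (ht : 0 < t) :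
    HasSum (fun j => (exp (-lam j * t) * inner ℝ (b j) h) • b j) (heatFlow b lam h t) :=
  (summable_mul_inner_smul_basis (hexp t ht) h).hasSum

theorem inner_heatFlow [CompleteSpace H]
    (hexp : ∀ t : ℝ, 0 < t → Summable fun j => exp (-lam j * t)) (h : H) {t : ℝ} (ht : 0 < t)
    (j : ι) : inner ℝ (b j) (heatFlow b lam h t) = exp (-lam j * t) * inner ℝ (b j) h :=
  inner_eq_of_hasSum_smul_basis (hasSum_heatFlow hexp h ht) j

theorem inner_self_heatFlow [CompleteSpace H]
    (hexp : ∀ t : ℝ, 0 < t → Summable fun j => exp (-lam j * t)) (h : H) {t : ℝ} (ht : 0 < t) :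
    inner ℝ h (heatFlow b lam h t) = ∑' j, exp (-lam j * t) * inner ℝ (b j) h ^ 2 := by
  rw [← b.tsum_inner_mul_inner]
  refine tsum_congr fun j => ?_
  rw [inner_heatFlow hexp h ht, real_inner_comm]
  ring

theorem hasDerivAt_heatFlow [CompleteSpace H] (hlam : ∀ j, 0 ≤ lam j)
    (hexp : ∀ t : ℝ, 0 < t → Summable fun j => exp (-lam j * t)) (h : H) {t : ℝ} (ht : 0 < t) :
    HasDerivAt (heatFlow b lam h)
      (-∑' j, (lam j * exp (-lam j * t) * inner ℝ (b j) h) • b j) t := by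
  have hasDerivAt_term : ∀ j, ∀ s ∈ Ioi (t / 2), HasDerivAt
      (fun s => (exp (-lam j * s) * inner ℝ (b j) h) • b j)
      (-((lam j * exp (-lam j * s) * inner ℝ (b j) h) • b j)) s := by
    intro j s _
    convert! ((((hasDerivAt_id s).const_mul (-lam j)).exp.mul_const
      (inner ℝ (b j) h)).smul_const (b j)) using 1
    rw [← neg_smul]
    simp only [id_eq, mul_one]
    ring_nf
  rw [← tsum_neg]
  refine hasDerivAt_tsum_of_isPreconnected
    ((summable_mul_exp hlam hexp (half_pos ht)).mul_right ‖h‖) isOpen_Ioi isPreconnected_Ioi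
    hasDerivAt_term (fun j s hs => ?_) (half_lt_self ht) (hasSum_heatFlow hexp h ht).summable
    (half_lt_self ht)
  rw [norm_neg]
  refine (norm_mul_inner_smul_basis_le b _ h j).trans ?_
  rw [abs_of_nonneg (mul_nonneg (hlam j) (exp_pos _).le)]
  have : -lam j * s ≤ -lam j * (t / 2) :=
    mul_le_mul_of_nonpos_left (mem_Ioi.1 hs).le (neg_nonpos.2 (hlam j))
  gcongr
  exact hlam j

theorem tendsto_heatFlow [CompleteSpace H] (hlam : ∀ j, 0 ≤ lam j)
    (hexp : ∀ t : ℝ, 0 < t → Summable fun j => exp (-lam j * t)) (h : H) :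
    Tendsto (heatFlow b lam h) (𝓝[>] 0) (𝓝 h) := by
  have norm_sq_eq : ∀ t : ℝ, 0 < t → ‖heatFlow b lam h t - h‖ ^ 2
      = ∑' j, ((exp (-lam j * t) - 1) * inner ℝ (b j) h) ^ 2 := fun t ht => by
    rw [norm_sq_eq_tsum_inner_sq b]
    exact tsum_congr fun j => by rw [inner_sub_right, inner_heatFlow hexp h ht, sub_mul, one_mul]
  have tendsto_sq : Tendsto (fun t => ∑' j, ((exp (-lam j * t) - 1) * inner ℝ (b j) h) ^ 2)
      (𝓝[>] 0) (𝓝 (∑' _ : ι, 0)) := by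
    refine tendsto_tsum_of_dominated_convergence (summable_inner_sq b h) (fun j => ?_) ?_
    · have : Continuous fun t => ((exp (-lam j * t) - 1) * inner ℝ (b j) h) ^ 2 := by fun_prop
      simpa using (this.tendsto 0).mono_left nhdsWithin_le_nhds
    · filter_upwards [self_mem_nhdsWithin] with t (ht : 0 < t) j
      have exp_le_one : exp (-lam j * t) ≤ 1 := exp_le_one_iff.2 (by nlinarith [hlam j])
      rw [norm_of_nonneg (sq_nonneg _), mul_pow]
      exact mul_le_of_le_one_left (sq_nonneg _) (by nlinarith [exp_pos (-lam j * t)])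
  rw [tsum_zero] at tendsto_sq
  rw [tendsto_iff_norm_sub_tendsto_zero]
  have tendsto_norm_sq : Tendsto (fun t => ‖heatFlow b lam h t - h‖ ^ 2) (𝓝[>] 0) (𝓝 0) :=
    tendsto_sq.congr' (eventually_nhdsWithin_of_forall fun t ht => (norm_sq_eq t ht).symm)
  simpa [sqrt_sq (norm_nonneg _)] using tendsto_norm_sq.sqrt

theorem eq_heatFlow_of_hasDerivAt [CompleteSpace H]
    (hexp : ∀ t : ℝ, 0 < t → Summable fun j => exp (-lam j * t)) {h : H} {u : ℝ → H}
    (hu : ∀ t, 0 < t → ∃ v, (∀ j, inner ℝ (b j) v = lam j * inner ℝ (b j) (u t)) ∧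
      HasDerivAt u (-v) t)
    (hlim : Tendsto u (𝓝[>] 0) (𝓝 h)) {t : ℝ} (ht : 0 < t) : u t = heatFlow b lam h t := by
  refine ext_inner_basis (b := b) fun j => ?_
  rw [inner_heatFlow hexp h ht]
  refine eq_exp_mul_of_hasDerivAt (y := fun s => inner ℝ (b j) (u s)) (fun s hs => ?_)
    (tendsto_const_nhds.inner hlim) ht
  obtain ⟨v, hv, huv⟩ := hu s hs
  simpa [inner_neg_right, hv] using (hasDerivAt_const s (b j)).inner ℝ huv

end HeatFlow

section DirichletSolution

/-- `φ` is a classical solution of `-φ'' + q φ = lam φ` on `[0,1]` with Dirichlet boundary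
conditions, and `φ'` is its derivative. -/
structure IsDirichletSolution (q : ℝ → ℝ) (lam : ℝ) (φ φ' : ℝ → ℝ) : Prop where
  hasDerivWithinAt : ∀ x ∈ Icc (0 : ℝ) 1, HasDerivWithinAt φ (φ' x) (Icc 0 1) x
  hasDerivWithinAt_deriv :
    ∀ x ∈ Icc (0 : ℝ) 1, HasDerivWithinAt φ' ((q x - lam) * φ x) (Icc 0 1) x
  left : φ 0 = 0
  right : φ 1 = 0

namespace IsDirichletSolution

variable {q φ φ' : ℝ → ℝ} {lam : ℝ}

theorem continuousOn (h : IsDirichletSolution q lam φ φ') : ContinuousOn φ (Icc 0 1) :=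
  fun x hx => (h.hasDerivWithinAt x hx).continuousWithinAt

theorem continuousOn_deriv (h : IsDirichletSolution q lam φ φ') : ContinuousOn φ' (Icc 0 1) :=
  fun x hx => (h.hasDerivWithinAt_deriv x hx).continuousWithinAt

theorem isH2Dirichlet (h : IsDirichletSolution q lam φ φ') (hq : ContinuousOn q (Icc 0 1)) :
    IsH2Dirichlet φ φ' fun x => (q x - lam) * φ x where
  memLp := memLp_unitMeasure_of_continuousOn ((hq.sub continuousOn_const).mul h.continuousOn)
  fst_deriv := eq_add_integral_of_hasDerivWithinAt h.hasDerivWithinAt h.continuousOn_deriv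
  snd_deriv := eq_add_integral_of_hasDerivWithinAt h.hasDerivWithinAt_deriv
    ((hq.sub continuousOn_const).mul h.continuousOn)
  left := h.left
  right := h.right

theorem schrodingerGraph (h : IsDirichletSolution q lam φ φ') (hq : ContinuousOn q (Icc 0 1))
    {Q v : L2} (hQ : Q =ᵐ[unitMeasure] q) (hv : v =ᵐ[unitMeasure] φ) :
    SchrodingerGraph Q v (lam • v) := by
  refine ⟨φ, φ', _, h.isH2Dirichlet hq, hv, ?_⟩
  filter_upwards [hQ, hv, Lp.coeFn_smul lam v] with x hQx hvx hlam
  rw [hlam, Pi.smul_apply, smul_eq_mul, hQx, hvx]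
  ring

end IsDirichletSolution

end DirichletSolution

section Sine

open Real

/-- The function `√2 sin(kπx)`: for `k ≥ 1`, the `k`-th normalized Dirichlet eigenfunction of
`-d²/dx²`. -/
def sine (k : ℕ) (x : ℝ) : ℝ := √2 * sin (k * π * x)

/-- The derivative of `sine k`. -/
def sineDeriv (k : ℕ) (x : ℝ) : ℝ := √2 * (k * π) * cos (k * π * x)

/-- For `k ≥ 1`, the `k`-th Dirichlet eigenvalue `(kπ)²` of `-d²/dx²`. -/
def sineEigenvalue (k : ℕ) : ℝ := (k * π) ^ 2

theorem continuous_sine (k : ℕ) : Continuous (sine k) := by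
  unfold sine
  fun_prop

theorem hasDerivAt_sine (k : ℕ) (x : ℝ) : HasDerivAt (sine k) (sineDeriv k x) x := by
  convert! (((hasDerivAt_id x).const_mul (k * π)).sin).const_mul √2 using 1
  simp only [sineDeriv, id_eq]
  ring

theorem hasDerivAt_sineDeriv (k : ℕ) (x : ℝ) :
    HasDerivAt (sineDeriv k) (-sineEigenvalue k * sine k x) x := by
  convert! (((hasDerivAt_id x).const_mul (k * π)).cos).const_mul (√2 * (k * π)) using 1
  simp only [sineEigenvalue, sine, id_eq]
  ring

theorem isDirichletSolution_sine (k : ℕ) :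
    IsDirichletSolution 0 (sineEigenvalue k) (sine k) (sineDeriv k) where
  hasDerivWithinAt x _ := (hasDerivAt_sine k x).hasDerivWithinAt
  hasDerivWithinAt_deriv x _ := by
    simpa only [Pi.zero_apply, zero_sub] using (hasDerivAt_sineDeriv k x).hasDerivWithinAt
  left := by simp [sine]
  right := by simp [sine, sin_nat_mul_pi]

theorem isH2Dirichlet_sine (k : ℕ) :
    IsH2Dirichlet (sine k) (sineDeriv k) fun x => -sineEigenvalue k * sine k x := by
  simpa using (isDirichletSolution_sine k).isH2Dirichlet continuousOn_const

theorem ae_eq_zero_of_integral_mul_sine_eq_zero {h : ℝ → ℝ} (hh : IntervalIntegrable h volume 0 1)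
    (horth : ∀ k : ℕ, ∫ x in (0 : ℝ)..1, h x * sine k x = 0) : h =ᵐ[unitMeasure] 0 := by
  refine ae_eq_zero_of_integral_mul_sin_eq_zero hh fun k => ?_
  have := horth k
  simp only [sine, mul_left_comm _ √2, intervalIntegral.integral_const_mul] at this
  exact (mul_eq_zero.1 this).resolve_left (by positivity)

end Sine

section SchrodingerGraph

namespace IsH2Dirichlet

variable {F F' F'' G G' G'' : ℝ → ℝ}

theorem intervalIntegrable_snd (hF : IsH2Dirichlet F F' F'') :
    IntervalIntegrable F'' volume 0 1 :=
  intervalIntegrable_of_memLp_unitMeasure hF.memLp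

theorem continuousOn_fst (hF : IsH2Dirichlet F F' F'') : ContinuousOn F' (Icc 0 1) :=
  continuousOn_of_eq_add_integral zero_le_one hF.intervalIntegrable_snd hF.snd_deriv

theorem intervalIntegrable_fst (hF : IsH2Dirichlet F F' F'') :
    IntervalIntegrable F' volume 0 1 :=
  hF.continuousOn_fst.intervalIntegrable_of_Icc zero_le_one

theorem continuousOn (hF : IsH2Dirichlet F F' F'') : ContinuousOn F (Icc 0 1) :=
  continuousOn_of_eq_add_integral zero_le_one hF.intervalIntegrable_fst hF.fst_deriv

theorem integral_snd_mul (hF : IsH2Dirichlet F F' F'') (hG : IsH2Dirichlet G G' G'') :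
    ∫ x in (0 : ℝ)..1, F'' x * G x = -∫ x in (0 : ℝ)..1, F' x * G' x := by
  have hu : uIcc (0 : ℝ) 1 = Icc 0 1 := uIcc_of_le zero_le_one
  have h := integral_deriv_mul_add_mul_deriv_of_eq_add_integral zero_le_one
    hF.intervalIntegrable_snd hF.snd_deriv hG.intervalIntegrable_fst hG.fst_deriv
  rw [intervalIntegral.integral_add (hF.intervalIntegrable_snd.mul_continuousOn
      (hu ▸ hG.continuousOn)) (hF.intervalIntegrable_fst.mul_continuousOn
      (hu ▸ hG.continuousOn_fst)), hG.left, hG.right] at h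
  linarith

theorem integral_snd_mul_comm (hF : IsH2Dirichlet F F' F'') (hG : IsH2Dirichlet G G' G'') :
    ∫ x in (0 : ℝ)..1, F'' x * G x = ∫ x in (0 : ℝ)..1, F x * G'' x := by
  simp only [mul_comm (F _)]
  rw [hF.integral_snd_mul hG, hG.integral_snd_mul hF]
  simp only [mul_comm (F' _)]

theorem ae_eq_of_integral_mul_sine {g p : ℝ → ℝ} (hF : IsH2Dirichlet F F' p)
    (hg : IntervalIntegrable g volume 0 1)
    (hweak : ∀ k, ∫ x in (0 : ℝ)..1, p x * sine k x
      = -sineEigenvalue k * ∫ x in (0 : ℝ)..1, g x * sine k x) :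
    g =ᵐ[unitMeasure] F := by
  have hF_int := hF.continuousOn.intervalIntegrable_of_Icc (μ := volume) zero_le_one
  have orthogonal : ∀ k : ℕ, ∫ x in (0 : ℝ)..1, (g x - F x) * sine k x = 0 := by
    intro k
    rcases k.eq_zero_or_pos with rfl | hk
    · simp [sine]
    have hlam : -sineEigenvalue k ≠ 0 := neg_ne_zero.2 (by unfold sineEigenvalue; positivity)
    have green := hF.integral_snd_mul_comm (isH2Dirichlet_sine k)
    simp only [mul_left_comm (F _), intervalIntegral.integral_const_mul] at green
    simp only [sub_mul]
    rw [intervalIntegral.integral_sub (hg.mul_continuousOn (continuous_sine k).continuousOn)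
      (hF_int.mul_continuousOn (continuous_sine k).continuousOn),
      mul_left_cancel₀ hlam ((hweak k).symm.trans green), sub_self]
  filter_upwards [ae_eq_zero_of_integral_mul_sine_eq_zero (hg.sub hF_int) orthogonal] with x hx
  exact sub_eq_zero.1 hx

end IsH2Dirichlet

theorem exists_isH2Dirichlet {p : ℝ → ℝ} (hp : MemLp p 2 unitMeasure) :
    ∃ F F', IsH2Dirichlet F F' p := by
  have hp_int := intervalIntegrable_of_memLp_unitMeasure hp
  set P : ℝ → ℝ := fun x => ∫ r in (0 : ℝ)..x, p r with hP
  have P_int : IntervalIntegrable P volume 0 1 :=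
    (continuousOn_of_eq_add_integral zero_le_one hp_int (P := P)
      (by simp [hP])).intervalIntegrable_of_Icc zero_le_one
  set c := -∫ r in (0 : ℝ)..1, P r with hc
  refine ⟨fun x => ∫ r in (0 : ℝ)..x, (c + P r), fun x => c + P x, hp,
    fun x _ => by simp, fun x _ => by simp [hP], by simp, ?_⟩
  simp only [intervalIntegral.integral_add intervalIntegrable_const P_int,
    intervalIntegral.integral_const, hc, sub_zero, one_smul, neg_add_cancel]

theorem inner_eq_inner_of_schrodingerGraph {Q g k g' k' : L2} (h : SchrodingerGraph Q g k)
    (h' : SchrodingerGraph Q g' k') : inner ℝ k g' = inner ℝ g k' := by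
  obtain ⟨F, F', F'', hF, hgF, hkF⟩ := h
  obtain ⟨G, G', G'', hG, hgG, hkG⟩ := h'
  have hu : uIcc (0 : ℝ) 1 = Icc 0 1 := uIcc_of_le zero_le_one
  have green : ∫ x in (0 : ℝ)..1, (F'' x * G x - F x * G'' x) = 0 := by
    rw [intervalIntegral.integral_sub
      (hF.intervalIntegrable_snd.mul_continuousOn (hu ▸ hG.continuousOn))
      (hG.intervalIntegrable_snd.continuousOn_mul (hu ▸ hF.continuousOn)),
      hF.integral_snd_mul_comm hG, sub_self]
  have integrable_mul (f h : L2) : Integrable (fun x => h x * f x) unitMeasure :=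
    (Lp.memLp h).integrable_mul (Lp.memLp f)
  rw [inner_eq_integral, inner_eq_integral, ← sub_eq_zero,
    ← integral_sub (integrable_mul k g') (integrable_mul g k'),
    ← neg_eq_zero, ← integral_neg, ← green, ← integral_unitMeasure]
  refine integral_congr_ae ?_
  filter_upwards [hgF, hkF, hgG, hkG] with x h₁ h₂ h₃ h₄
  rw [h₁, h₂, h₃, h₄]
  ring

/-- `sine k` as an element of `L²[0,1]`. -/
def sineVec (k : ℕ) : L2 :=
  (memLp_unitMeasure_of_continuousOn (continuous_sine k).continuousOn).toLp (sine k)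

theorem sineVec_ae_eq (k : ℕ) : sineVec k =ᵐ[unitMeasure] sine k := MemLp.coeFn_toLp _

theorem inner_sineVec (k : ℕ) (h : L2) :
    inner ℝ (sineVec k) h = ∫ x in (0 : ℝ)..1, h x * sine k x := by
  rw [inner_eq_integral, ← integral_unitMeasure]
  refine integral_congr_ae ?_
  filter_upwards [sineVec_ae_eq k] with x hx
  rw [hx]

theorem exists_schrodingerGraph_sineVec {Q : L2} (hQ : MemLp Q ⊤ unitMeasure) (k : ℕ) :
    ∃ w, SchrodingerGraph Q (sineVec k) w ∧
      w =ᵐ[unitMeasure] fun x => (Q x + sineEigenvalue k) * sine k x := by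
  have hp : MemLp (fun x => (Q x + sineEigenvalue k) * sine k x) 2 unitMeasure :=
    (memLp_unitMeasure_of_continuousOn (p := 2) (continuous_sine k).continuousOn).mul'
      (hQ.add (memLp_const _))
  refine ⟨hp.toLp, ⟨sine k, sineDeriv k, _, isH2Dirichlet_sine k, sineVec_ae_eq k, ?_⟩,
    hp.coeFn_toLp⟩
  filter_upwards [hp.coeFn_toLp] with x hx
  rw [hx]
  ring

theorem schrodingerGraph_of_forall_inner_sineVec {Q g k : L2} (hQ : MemLp Q ⊤ unitMeasure)
    (hweak : ∀ j w, SchrodingerGraph Q (sineVec j) w → inner ℝ w g = inner ℝ (sineVec j) k) :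
    SchrodingerGraph Q g k := by
  have hQg : MemLp (fun x => Q x * g x) 2 unitMeasure := (Lp.memLp g).mul' hQ
  have hp : MemLp (fun x => Q x * g x - k x) 2 unitMeasure := hQg.sub (Lp.memLp k)
  obtain ⟨F, F', hF⟩ := exists_isH2Dirichlet hp
  have weak_second_deriv : ∀ j, ∫ x in (0 : ℝ)..1, (Q x * g x - k x) * sine j x
      = -sineEigenvalue j * ∫ x in (0 : ℝ)..1, g x * sine j x := by
    intro j
    obtain ⟨w, hw, hw_ae⟩ := exists_schrodingerGraph_sineVec hQ j
    have h : inner ℝ (w - sineEigenvalue j • sineVec j) g - inner ℝ (sineVec j) k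
        = -sineEigenvalue j * inner ℝ (sineVec j) g := by
      rw [inner_sub_left, real_inner_smul_left, hweak j w hw]
      ring
    rw [inner_sineVec j g] at h
    rw [← h, inner_eq_integral, inner_eq_integral, ← integral_sub
      ((Lp.memLp _).integrable_mul (Lp.memLp _)) ((Lp.memLp _).integrable_mul (Lp.memLp _)),
      ← integral_unitMeasure]
    refine integral_congr_ae ?_
    filter_upwards [hw_ae, sineVec_ae_eq j, Lp.coeFn_sub w (sineEigenvalue j • sineVec j),
      Lp.coeFn_smul (sineEigenvalue j) (sineVec j)] with x h₁ h₂ h₃ h₄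
    rw [h₃, Pi.sub_apply, h₄, Pi.smul_apply, smul_eq_mul, h₁, h₂]
    ring
  have hgF := hF.ae_eq_of_integral_mul_sine
    (intervalIntegrable_of_memLp_unitMeasure (Lp.memLp g)) weak_second_deriv
  refine ⟨F, F', _, hF, hgF, ?_⟩
  filter_upwards [hgF] with x hx
  rw [hx]
  ring

theorem SchrodingerGraph.const_smul {Q g k : L2} (h : SchrodingerGraph Q g k) (c : ℝ) :
    SchrodingerGraph Q (c • g) (c • k) := by
  obtain ⟨F, F', F'', hF, hgF, hkF⟩ := h
  refine ⟨fun x => c * F x, fun x => c * F' x, fun x => c * F'' x,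
    ⟨hF.memLp.const_mul c, fun x hx => ?_, fun x hx => ?_, ?_, ?_⟩, ?_, ?_⟩
  · rw [hF.fst_deriv x hx, intervalIntegral.integral_const_mul, mul_add]
  · rw [hF.snd_deriv x hx, intervalIntegral.integral_const_mul, mul_add]
  · rw [hF.left, mul_zero]
  · rw [hF.right, mul_zero]
  · filter_upwards [hgF, Lp.coeFn_smul c g] with x hx hc
    rw [hc, Pi.smul_apply, smul_eq_mul, hx]
  · filter_upwards [hkF, Lp.coeFn_smul c k] with x hx hc
    rw [hc, Pi.smul_apply, smul_eq_mul, hx]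
    ring

theorem schrodingerGraph_of_hasSum {ι : Type*} {Q : L2} (hQ : MemLp Q ⊤ unitMeasure) {g k : ι → L2}
    {G K : L2} (hgk : ∀ i, SchrodingerGraph Q (g i) (k i)) (hG : HasSum g G) (hK : HasSum k K) :
    SchrodingerGraph Q G K := by
  refine schrodingerGraph_of_forall_inner_sineVec hQ fun j w hw => ?_
  refine (hG.mapL (innerSL ℝ w)).unique ?_
  simpa only [innerSL_apply_apply, inner_eq_inner_of_schrodingerGraph hw (hgk _)] using
    hK.mapL (innerSL ℝ (sineVec j))

end SchrodingerGraph

section EigenBasis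

variable {Q : L2} {ι : Type*} {b : HilbertBasis ι ℝ L2} {lam : ι → ℝ}

theorem inner_basis_of_schrodingerGraph (hb : ∀ j, SchrodingerGraph Q (b j) (lam j • b j))
    {g k : L2} (h : SchrodingerGraph Q g k) (j : ι) :
    inner ℝ (b j) k = lam j * inner ℝ (b j) g := by
  rw [← inner_eq_inner_of_schrodingerGraph (hb j) h, real_inner_smul_left]

theorem isEigenvalue_iff_mem_range (hb : ∀ j, SchrodingerGraph Q (b j) (lam j • b j)) (l : ℝ) :
    IsEigenvalue Q l ↔ l ∈ range lam := by
  constructor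
  · rintro ⟨g, hg₀, hg⟩
    by_contra hl
    refine hg₀ (ext_inner_basis (b := b) fun j => ?_)
    have h := inner_basis_of_schrodingerGraph hb hg j
    rw [inner_smul_right] at h
    rw [inner_zero_right]
    exact (mul_eq_mul_right_iff.1 h).resolve_left fun h => hl ⟨j, h.symm⟩
  · rintro ⟨j, rfl⟩
    exact ⟨b j, b.orthonormal.ne_zero j, hb j⟩

theorem isospectral_of_basis {Q₁ Q₂ : L2} {b₁ b₂ : HilbertBasis ι ℝ L2}
    (hb₁ : ∀ j, SchrodingerGraph Q₁ (b₁ j) (lam j • b₁ j))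
    (hb₂ : ∀ j, SchrodingerGraph Q₂ (b₂ j) (lam j • b₂ j)) : Isospectral Q₁ Q₂ := by
  intro j _ l
  simp only [IsNthEigenvalue, isEigenvalue_iff_mem_range hb₁, isEigenvalue_iff_mem_range hb₂]

theorem isNthEigenvalue_of_strictMono {b : HilbertBasis ℕ ℝ L2} {lam : ℕ → ℝ}
    (hlam : StrictMono lam) (hb : ∀ j, SchrodingerGraph Q (b j) (lam j • b j)) (j : ℕ) :
    IsNthEigenvalue Q (j + 1) (lam j) := by
  refine ⟨(isEigenvalue_iff_mem_range hb _).2 (mem_range_self j), ?_⟩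
  have eigenvalues_below : {m : ℝ | IsEigenvalue Q m ∧ m < lam j} = lam '' Iio j := by
    ext m
    simp only [isEigenvalue_iff_mem_range hb, mem_ofPred_eq, mem_image, mem_Iio]
    constructor
    · rintro ⟨⟨i, rfl⟩, h⟩
      exact ⟨i, hlam.lt_iff_lt.1 h, rfl⟩
    · rintro ⟨i, h, rfl⟩
      exact ⟨mem_range_self i, hlam h⟩
  rw [eigenvalues_below, hlam.injective.encard_image, ← Finset.coe_Iio,
    encard_coe_eq_coe_finsetCard, Nat.card_Iio]
  norm_cast

/-- The constant function `1` in `L²[0,1]`. -/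
abbrev one : L2 := Lp.const 2 unitMeasure (1 : ℝ)

theorem inner_one (h : L2) : inner ℝ one h = ∫ x, h x ∂unitMeasure := by
  rw [inner_eq_integral]
  refine integral_congr_ae ?_
  filter_upwards [Lp.coeFn_const (μ := unitMeasure) (p := 2) (1 : ℝ)] with x hx
  rw [hx, Function.const_apply, mul_one]

section Heat

variable (hQ : MemLp Q ⊤ unitMeasure) (hlam : ∀ j, 0 ≤ lam j)
  (hexp : ∀ t : ℝ, 0 < t → Summable fun j => Real.exp (-lam j * t))
  (hb : ∀ j, SchrodingerGraph Q (b j) (lam j • b j))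

include hQ hlam hexp hb

theorem isHeatSolution_heatFlow : IsHeatSolution Q (heatFlow b lam one) := by
  refine ⟨fun t ht => ⟨_, schrodingerGraph_of_hasSum hQ (fun j => ?_) (hasSum_heatFlow hexp one ht)
    (summable_mul_inner_smul_basis (summable_mul_exp hlam hexp ht) one).hasSum,
    hasDerivAt_heatFlow hlam hexp one ht⟩, tendsto_heatFlow hlam hexp one⟩
  convert! (hb j).const_smul (Real.exp (-lam j * t) * inner ℝ (b j) one) using 1
  rw [smul_smul]
  ring_nf

theorem heatContent_eq_tsum {t : ℝ} (ht : 0 < t) :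
    heatContent Q t = ∑' j, Real.exp (-lam j * t) * (∫ x, b j x ∂unitMeasure) ^ 2 := by
  have hex : ∃ u, IsHeatSolution Q u := ⟨_, isHeatSolution_heatFlow hQ hlam hexp hb⟩
  have choose_eq : hex.choose t = heatFlow b lam one t :=
    eq_heatFlow_of_hasDerivAt hexp (fun s hs => by
      obtain ⟨v, hv, hderiv⟩ := hex.choose_spec.1 s hs
      exact ⟨v, inner_basis_of_schrodingerGraph hb hv, hderiv⟩) hex.choose_spec.2 ht
  rw [heatContent, dif_pos hex, choose_eq, ← inner_one, inner_self_heatFlow hexp one ht]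
  exact tsum_congr fun j => by rw [real_inner_comm, inner_one]

end Heat

theorem sq_integral_basis_eq_of_isIsoheat {Q₁ Q₂ : L2} {b₁ b₂ : HilbertBasis ℕ ℝ L2} {lam : ℕ → ℝ}
    (hQ₁ : MemLp Q₁ ⊤ unitMeasure) (hQ₂ : MemLp Q₂ ⊤ unitMeasure)
    (hlam : ∀ j, 0 ≤ lam j) (hmono : StrictMono lam)
    (hexp : ∀ t : ℝ, 0 < t → Summable fun j => Real.exp (-lam j * t))
    (hb₁ : ∀ j, SchrodingerGraph Q₁ (b₁ j) (lam j • b₁ j))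
    (hb₂ : ∀ j, SchrodingerGraph Q₂ (b₂ j) (lam j • b₂ j)) (h : IsIsoheat Q₁ Q₂) (j : ℕ) :
    (∫ x, b₁ j x ∂unitMeasure) ^ 2 = (∫ x, b₂ j x ∂unitMeasure) ^ 2 := by
  have summable_sq (b : HilbertBasis ℕ ℝ L2) :
      Summable fun j => (∫ x, b j x ∂unitMeasure) ^ 2 :=
    (summable_inner_sq b one).congr fun j => by rw [real_inner_comm, inner_one]
  have summable_exp_mul_sq (b : HilbertBasis ℕ ℝ L2) {t : ℝ} (ht : 0 < t) :
      Summable fun j => Real.exp (-lam j * t) * (∫ x, b j x ∂unitMeasure) ^ 2 :=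
    (summable_sq b).of_nonneg_of_le (fun j => by positivity) fun j =>
      mul_le_of_le_one_left (sq_nonneg _) (Real.exp_le_one_iff.2 (by nlinarith [hlam j]))
  refine sub_eq_zero.1 (eq_zero_of_tsum_exp_mul_eq_zero hmono
    ((summable_sq b₁).sub (summable_sq b₂)).abs (fun t ht => ?_) j)
  simp only [mul_sub]
  rw [(summable_exp_mul_sq b₁ ht).tsum_sub (summable_exp_mul_sq b₂ ht),
    ← heatContent_eq_tsum hQ₁ hlam hexp hb₁ ht, ← heatContent_eq_tsum hQ₂ hlam hexp hb₂ ht,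
    h t ht, sub_self]

end EigenBasis

section Commutation

/-- The tail inner product `∫ₓ¹ φ ψ`. -/
def tailInner (φ ψ : ℝ → ℝ) (x : ℝ) : ℝ := ∫ r in x..(1 : ℝ), φ r * ψ r

/-- The tau function `1 + c ∫ₓ¹ φ²` of the double commutation method. -/
def tau (c : ℝ) (φ : ℝ → ℝ) (x : ℝ) : ℝ := 1 + c * tailInner φ φ x

/-- The function `φ / τ`, which solves the commuted equation at the eigenvalue of `φ`. -/
def tauQuotient (c : ℝ) (φ : ℝ → ℝ) (x : ℝ) : ℝ := φ x / tau c φ x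

/-- The derivative of `tauQuotient c φ`, when `φ'` is the derivative of `φ`. -/
def tauQuotientDeriv (c : ℝ) (φ φ' : ℝ → ℝ) (x : ℝ) : ℝ :=
  φ' x / tau c φ x + c * φ x ^ 3 / tau c φ x ^ 2

/-- The double commutation `q - 2 (log τ)''` of the potential `q`, with the second derivative
`(log τ)'' = -c (φ · φ / τ)'` carried out. -/
def commutedPotential (q : ℝ → ℝ) (c : ℝ) (φ φ' : ℝ → ℝ) (x : ℝ) : ℝ :=
  q x + 2 * c * (φ' x * tauQuotient c φ x + φ x * tauQuotientDeriv c φ φ' x)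

/-- The double commutation `ψ - c (φ / τ) ∫ₓ¹ φ ψ`, which carries solutions for `q` to solutions for
`commutedPotential q c φ φ'` at the same spectral parameter. -/
def commutation (c : ℝ) (φ ψ : ℝ → ℝ) (x : ℝ) : ℝ :=
  ψ x - c * (tauQuotient c φ x * tailInner φ ψ x)

/-- The derivative of `commutation c φ ψ`, when `φ'` and `ψ'` are the derivatives of `φ` and `ψ`. -/
def commutationDeriv (c : ℝ) (φ φ' ψ ψ' : ℝ → ℝ) (x : ℝ) : ℝ :=
  ψ' x - c * (tauQuotientDeriv c φ φ' x * tailInner φ ψ x - tauQuotient c φ x * (φ x * ψ x))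

variable {c : ℝ} {φ φ' ψ ψ' χ : ℝ → ℝ}

theorem tailInner_one (φ ψ : ℝ → ℝ) : tailInner φ ψ 1 = 0 := intervalIntegral.integral_same

theorem hasDerivWithinAt_tailInner (hφ : ContinuousOn φ (Icc 0 1))
    (hψ : ContinuousOn ψ (Icc 0 1)) {x : ℝ} (hx : x ∈ Icc (0 : ℝ) 1) :
    HasDerivWithinAt (tailInner φ ψ) (-(φ x * ψ x)) (Icc 0 1) x :=
  hasDerivWithinAt_integral_left_endpoint (hφ.mul hψ) hx

theorem continuousOn_tailInner (hφ : ContinuousOn φ (Icc 0 1)) (hψ : ContinuousOn ψ (Icc 0 1)) :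
    ContinuousOn (tailInner φ ψ) (Icc 0 1) :=
  fun _ hx => (hasDerivWithinAt_tailInner hφ hψ hx).continuousWithinAt

theorem tau_pos (hφ : ContinuousOn φ (Icc 0 1)) (hnorm : ∫ x in (0 : ℝ)..1, φ x * φ x = 1)
    (hc : -1 < c) {x : ℝ} (hx : x ∈ Icc (0 : ℝ) 1) : 0 < tau c φ x := by
  have integrable : ∀ {a b : ℝ}, 0 ≤ a → a ≤ b → b ≤ 1 →
      IntervalIntegrable (fun r => φ r * φ r) volume a b := fun ha hab hb =>
    ((hφ.mul hφ).mono (Icc_subset_Icc ha hb)).intervalIntegrable_of_Icc hab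
  have head_nonneg : 0 ≤ ∫ r in (0 : ℝ)..x, φ r * φ r :=
    intervalIntegral.integral_nonneg hx.1 fun r _ => mul_self_nonneg _
  have tail_nonneg : 0 ≤ tailInner φ φ x :=
    intervalIntegral.integral_nonneg hx.2 fun r _ => mul_self_nonneg _
  have tail_le_one : tailInner φ φ x ≤ 1 := by
    have := intervalIntegral.integral_add_adjacent_intervals
      (integrable le_rfl hx.1 hx.2) (integrable hx.1 hx.2 le_rfl)
    rw [tailInner]
    linarith
  rw [tau]
  rcases le_or_gt 0 c with hc₀ | hc₀
  · positivity
  · nlinarith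

theorem hasDerivWithinAt_tau (c : ℝ) (hφ : ContinuousOn φ (Icc 0 1)) {x : ℝ}
    (hx : x ∈ Icc (0 : ℝ) 1) :
    HasDerivWithinAt (tau c φ) (-(c * φ x ^ 2)) (Icc 0 1) x := by
  convert! ((hasDerivWithinAt_tailInner hφ hφ hx).const_mul c).const_add 1 using 1
  ring

theorem hasDerivWithinAt_tauQuotient {x : ℝ} (hφ : ContinuousOn φ (Icc 0 1))
    (hx : x ∈ Icc (0 : ℝ) 1) (hτ : tau c φ x ≠ 0)
    (hderiv : HasDerivWithinAt φ (φ' x) (Icc 0 1) x) :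
    HasDerivWithinAt (tauQuotient c φ) (tauQuotientDeriv c φ φ' x) (Icc 0 1) x := by
  convert! hderiv.div (hasDerivWithinAt_tau c hφ hx) hτ using 1
  rw [tauQuotientDeriv]
  field_simp
  ring

theorem hasDerivWithinAt_commutation {x : ℝ} (hφ : ContinuousOn φ (Icc 0 1))
    (hψ : ContinuousOn ψ (Icc 0 1)) (hx : x ∈ Icc (0 : ℝ) 1) (hτ : tau c φ x ≠ 0)
    (hφ' : HasDerivWithinAt φ (φ' x) (Icc 0 1) x)
    (hψ' : HasDerivWithinAt ψ (ψ' x) (Icc 0 1) x) :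
    HasDerivWithinAt (commutation c φ ψ) (commutationDeriv c φ φ' ψ ψ' x) (Icc 0 1) x := by
  convert! hψ'.sub (((hasDerivWithinAt_tauQuotient hφ hx hτ hφ').mul
    (hasDerivWithinAt_tailInner hφ hψ hx)).const_mul c) using 1
  rw [commutationDeriv]
  ring

theorem commutation_self {x : ℝ} (hτ : tau c φ x ≠ 0) :
    commutation c φ φ x = tauQuotient c φ x := by
  rw [commutation, tauQuotient]
  field_simp
  rw [tau]
  ring

theorem commutationDeriv_self {x : ℝ} (hτ : tau c φ x ≠ 0) :
    commutationDeriv c φ φ' φ φ' x = tauQuotientDeriv c φ φ' x := by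
  rw [commutationDeriv, tauQuotientDeriv, tauQuotient]
  field_simp
  rw [tau]
  ring

theorem continuousOn_tau (hφ : ContinuousOn φ (Icc 0 1)) : ContinuousOn (tau c φ) (Icc 0 1) :=
  fun _ hx => (hasDerivWithinAt_tau c hφ hx).continuousWithinAt

theorem continuousOn_tauQuotient (hφ : ContinuousOn φ (Icc 0 1))
    (hτ : ∀ x ∈ Icc (0 : ℝ) 1, tau c φ x ≠ 0) : ContinuousOn (tauQuotient c φ) (Icc 0 1) :=
  hφ.div (continuousOn_tau hφ) hτ

theorem continuousOn_tauQuotientDeriv (hφ : ContinuousOn φ (Icc 0 1))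
    (hφ' : ContinuousOn φ' (Icc 0 1)) (hτ : ∀ x ∈ Icc (0 : ℝ) 1, tau c φ x ≠ 0) :
    ContinuousOn (tauQuotientDeriv c φ φ') (Icc 0 1) :=
  (hφ'.div (continuousOn_tau hφ) hτ).add ((continuousOn_const.mul (hφ.pow 3)).div
    ((continuousOn_tau hφ).pow 2) fun x hx => pow_ne_zero 2 (hτ x hx))

theorem continuousOn_commutedPotential {q : ℝ → ℝ} (hq : ContinuousOn q (Icc 0 1))
    (hφ : ContinuousOn φ (Icc 0 1)) (hφ' : ContinuousOn φ' (Icc 0 1))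
    (hτ : ∀ x ∈ Icc (0 : ℝ) 1, tau c φ x ≠ 0) :
    ContinuousOn (commutedPotential q c φ φ') (Icc 0 1) :=
  hq.add (continuousOn_const.mul ((hφ'.mul (continuousOn_tauQuotient hφ hτ)).add
    (hφ.mul (continuousOn_tauQuotientDeriv hφ hφ' hτ))))

theorem continuousOn_commutation (hφ : ContinuousOn φ (Icc 0 1)) (hψ : ContinuousOn ψ (Icc 0 1))
    (hτ : ∀ x ∈ Icc (0 : ℝ) 1, tau c φ x ≠ 0) : ContinuousOn (commutation c φ ψ) (Icc 0 1) :=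
  hψ.sub (continuousOn_const.mul
    ((continuousOn_tauQuotient hφ hτ).mul (continuousOn_tailInner hφ hψ)))

theorem commutedPotential_eq_sub_iteratedDeriv {q : ℝ → ℝ}
    (hφ : ∀ x ∈ Icc (0 : ℝ) 1, HasDerivWithinAt φ (φ' x) (Icc 0 1) x)
    (hτ : ∀ x ∈ Icc (0 : ℝ) 1, tau c φ x ≠ 0) {x : ℝ} (hx : x ∈ Ioo (0 : ℝ) 1) :
    commutedPotential q c φ φ' x =
      q x - 2 * iteratedDeriv 2 (fun y => Real.log (tau c φ y)) x := by
  have hφ_cont : ContinuousOn φ (Icc 0 1) := fun y hy => (hφ y hy).continuousWithinAt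
  have mem_nhds : ∀ y ∈ Ioo (0 : ℝ) 1, Icc (0 : ℝ) 1 ∈ 𝓝 y := fun y hy =>
    Icc_mem_nhds hy.1 hy.2
  have deriv_log : deriv (fun y => Real.log (tau c φ y)) =ᶠ[𝓝 x]
      fun y => -(c * (φ y * tauQuotient c φ y)) := by
    filter_upwards [isOpen_Ioo.mem_nhds hx] with y hy
    have hy' := Ioo_subset_Icc_self hy
    rw [(((hasDerivWithinAt_tau c hφ_cont hy').hasDerivAt (mem_nhds y hy)).log (hτ y hy')).deriv,
      tauQuotient]
    ring
  have hx' := Ioo_subset_Icc_self hx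
  have second_deriv := ((((hφ x hx').mul (hasDerivWithinAt_tauQuotient hφ_cont hx' (hτ x hx')
    (hφ x hx'))).const_mul c).neg).hasDerivAt (mem_nhds x hx)
  rw [iteratedDeriv_succ, iteratedDeriv_one, deriv_log.deriv_eq, commutedPotential]
  linear_combination 2 * second_deriv.deriv

section Solution

variable {q : ℝ → ℝ} {μ lam : ℝ}

namespace IsDirichletSolution

theorem const_mul (h : IsDirichletSolution q lam φ φ') (a : ℝ) :
    IsDirichletSolution q lam (fun x => a * φ x) (fun x => a * φ' x) where
  hasDerivWithinAt x hx := (h.hasDerivWithinAt x hx).const_mul a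
  hasDerivWithinAt_deriv x hx := by
    convert! (h.hasDerivWithinAt_deriv x hx).const_mul a using 1
    ring
  left := by rw [h.left, mul_zero]
  right := by rw [h.right, mul_zero]

theorem wronskian (hφ : IsDirichletSolution q μ φ φ') (hψ : IsDirichletSolution q lam ψ ψ') {x : ℝ}
    (hx : x ∈ Icc (0 : ℝ) 1) :
    φ x * ψ' x - φ' x * ψ x = (lam - μ) * tailInner φ ψ x := by
  set d : ℝ → ℝ := fun x => φ x * ψ' x - φ' x * ψ x - (lam - μ) * tailInner φ ψ x
  have hd : ∀ x ∈ Icc (0 : ℝ) 1, HasDerivWithinAt d 0 (Icc 0 1) x := fun x hx => by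
    convert! (((hφ.hasDerivWithinAt x hx).mul (hψ.hasDerivWithinAt_deriv x hx)).sub
      ((hφ.hasDerivWithinAt_deriv x hx).mul (hψ.hasDerivWithinAt x hx))).sub
      ((hasDerivWithinAt_tailInner hφ.continuousOn hψ.continuousOn hx).const_mul (lam - μ)) using 1
    ring
  have hd_one : d 1 = 0 := by simp [d, hφ.right, hψ.right, tailInner_one]
  have hd_const : d x = d 1 := by
    have const := eq_add_integral_of_hasDerivWithinAt hd continuousOn_const
    simp only [intervalIntegral.integral_zero, add_zero] at const
    rw [const x hx, const 1 (right_mem_Icc.2 zero_le_one)]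
  exact sub_eq_zero.1 (hd_const.trans hd_one)

theorem hasDerivWithinAt_tauQuotientDeriv (hφ : IsDirichletSolution q μ φ φ') {x : ℝ}
    (hx : x ∈ Icc (0 : ℝ) 1) (hτ : tau c φ x ≠ 0) :
    HasDerivWithinAt (tauQuotientDeriv c φ φ')
      ((commutedPotential q c φ φ' x - μ) * tauQuotient c φ x) (Icc 0 1) x := by
  have hτ' := hasDerivWithinAt_tau c hφ.continuousOn hx
  convert! ((hφ.hasDerivWithinAt_deriv x hx).div hτ' hτ).add
    ((((hφ.hasDerivWithinAt x hx).pow 3).const_mul c).div (hτ'.pow 2) (pow_ne_zero 2 hτ)) using 1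
  simp only [commutedPotential, tauQuotient, tauQuotientDeriv, Pi.pow_apply]
  field_simp
  ring

theorem commutation (hφ : IsDirichletSolution q μ φ φ') (hψ : IsDirichletSolution q lam ψ ψ')
    (hτ : ∀ x ∈ Icc (0 : ℝ) 1, tau c φ x ≠ 0) :
    IsDirichletSolution (commutedPotential q c φ φ') lam (commutation c φ ψ)
      (commutationDeriv c φ φ' ψ ψ') where
  hasDerivWithinAt x hx := hasDerivWithinAt_commutation hφ.continuousOn hψ.continuousOn hx (hτ x hx)
    (hφ.hasDerivWithinAt x hx) (hψ.hasDerivWithinAt x hx)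
  hasDerivWithinAt_deriv x hx := by
    have hχ := hasDerivWithinAt_tauQuotient hφ.continuousOn hx (hτ x hx) (hφ.hasDerivWithinAt x hx)
    convert! (hψ.hasDerivWithinAt_deriv x hx).sub
      ((((hφ.hasDerivWithinAt_tauQuotientDeriv hx (hτ x hx)).mul
        (hasDerivWithinAt_tailInner hφ.continuousOn hψ.continuousOn hx)).sub
        (hχ.mul ((hφ.hasDerivWithinAt x hx).mul (hψ.hasDerivWithinAt x hx)))).const_mul c) using 1
    simp only [Isoheat.commutation, commutedPotential, Pi.mul_apply]
    linear_combination (-c * tauQuotient c φ x) * hφ.wronskian hψ hx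
  left := by simp [Isoheat.commutation, tauQuotient, hφ.left, hψ.left]
  right := by simp [Isoheat.commutation, tauQuotient, hφ.right, hψ.right]

end IsDirichletSolution

end Solution

theorem integral_commutation_mul_commutation (hφ : ContinuousOn φ (Icc 0 1))
    (hψ : ContinuousOn ψ (Icc 0 1)) (hχ : ContinuousOn χ (Icc 0 1))
    (hτ : ∀ x ∈ Icc (0 : ℝ) 1, tau c φ x ≠ 0) :
    ∫ x in (0 : ℝ)..1, commutation c φ ψ x * commutation c φ χ x =
      (∫ x in (0 : ℝ)..1, ψ x * χ x)
        - c * ((∫ x in (0 : ℝ)..1, φ x * ψ x) * (∫ x in (0 : ℝ)..1, φ x * χ x) / tau c φ 0) := by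
  have hderiv : ∀ x ∈ Icc (0 : ℝ) 1, HasDerivWithinAt
      (fun x => c * (tailInner φ ψ x * tailInner φ χ x / tau c φ x) - tailInner ψ χ x)
      (commutation c φ ψ x * commutation c φ χ x) (Icc 0 1) x := fun x hx => by
    have hτx := hτ x hx
    convert! ((((hasDerivWithinAt_tailInner hφ hψ hx).mul
      (hasDerivWithinAt_tailInner hφ hχ hx)).div (hasDerivWithinAt_tau c hφ hx) hτx).const_mul
      c).sub (hasDerivWithinAt_tailInner hψ hχ hx) using 1
    simp only [commutation, tauQuotient, Pi.mul_apply]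
    field_simp
    ring
  have h := eq_add_integral_of_hasDerivWithinAt hderiv ((continuousOn_commutation hφ hψ hτ).mul
    (continuousOn_commutation hφ hχ hτ)) 1 (right_mem_Icc.2 zero_le_one)
  simp only [tailInner_one, mul_zero, zero_div, sub_zero] at h
  simp only [tailInner] at h
  linarith

theorem integral_mul_commutation {h : ℝ → ℝ} (hh : IntervalIntegrable h volume 0 1)
    (hφ : ContinuousOn φ (Icc 0 1)) (hψ : ContinuousOn ψ (Icc 0 1))
    (hτ : ∀ x ∈ Icc (0 : ℝ) 1, tau c φ x ≠ 0) :
    ∫ x in (0 : ℝ)..1, h x * commutation c φ ψ x = ∫ x in (0 : ℝ)..1,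
      (h x - c * φ x * ∫ r in (0 : ℝ)..x, h r * tauQuotient c φ r) * ψ x := by
  have hu : uIcc (0 : ℝ) 1 = Icc 0 1 := uIcc_of_le zero_le_one
  set A : ℝ → ℝ := fun x => ∫ r in (0 : ℝ)..x, h r * tauQuotient c φ r
  have hχ := continuousOn_tauQuotient hφ hτ
  have hhχ : IntervalIntegrable (fun r => h r * tauQuotient c φ r) volume 0 1 :=
    hh.mul_continuousOn (hu ▸ hχ)
  have hA : ∀ x ∈ Icc (0 : ℝ) 1, A x = A 0 + ∫ r in (0 : ℝ)..x, h r * tauQuotient c φ r := by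
    simp [A]
  have hA_cont : ContinuousOn A (Icc 0 1) := continuousOn_of_eq_add_integral zero_le_one hhχ hA
  have hφψ : ContinuousOn (fun x => -(φ x * ψ x)) (Icc 0 1) := (hφ.mul hψ).neg
  have parts_int : IntervalIntegrable
      (fun x => h x * tauQuotient c φ x * tailInner φ ψ x + A x * -(φ x * ψ x)) volume 0 1 :=
    (hhχ.mul_continuousOn (hu ▸ continuousOn_tailInner hφ hψ)).add
      ((hA_cont.mul hφψ).intervalIntegrable_of_Icc zero_le_one)
  have by_parts : ∫ x in (0 : ℝ)..1,
      (h x * tauQuotient c φ x * tailInner φ ψ x + A x * -(φ x * ψ x)) = 0 := by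
    rw [integral_deriv_mul_add_mul_deriv_of_eq_add_integral zero_le_one hhχ hA
      (hφψ.intervalIntegrable_of_Icc zero_le_one) (eq_add_integral_of_hasDerivWithinAt
        (fun x hx => hasDerivWithinAt_tailInner hφ hψ hx) hφψ), tailInner_one]
    simp [A]
  calc ∫ x in (0 : ℝ)..1, h x * commutation c φ ψ x
    _ = (∫ x in (0 : ℝ)..1, h x * commutation c φ ψ x) + ∫ x in (0 : ℝ)..1,
          c * (h x * tauQuotient c φ x * tailInner φ ψ x + A x * -(φ x * ψ x)) := by
        rw [intervalIntegral.integral_const_mul, by_parts, mul_zero, add_zero]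
    _ = ∫ x in (0 : ℝ)..1, (h x - c * φ x * A x) * ψ x := by
        rw [← intervalIntegral.integral_add
          (hh.mul_continuousOn (hu ▸ continuousOn_commutation hφ hψ hτ)) (parts_int.const_mul c)]
        congr 1
        funext x
        simp only [commutation]
        ring

theorem ae_eq_zero_of_ae_eq_mul_integral_tauQuotient {h : ℝ → ℝ} (hφ : ContinuousOn φ (Icc 0 1))
    (hτ : ∀ x ∈ Icc (0 : ℝ) 1, tau c φ x ≠ 0) (hh : IntervalIntegrable h volume 0 1)
    (heq : h =ᵐ[unitMeasure] fun x => c * φ x * ∫ r in (0 : ℝ)..x, h r * tauQuotient c φ r) :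
    h =ᵐ[unitMeasure] 0 := by
  have hu : uIcc (0 : ℝ) 1 = Icc 0 1 := uIcc_of_le zero_le_one
  set A : ℝ → ℝ := fun x => ∫ r in (0 : ℝ)..x, h r * tauQuotient c φ r with hA
  have hhA : h =ᵐ[unitMeasure] fun x => c * φ x * A x := heq
  have hχ := continuousOn_tauQuotient hφ hτ
  have hA_cont : ContinuousOn A (Icc 0 1) := continuousOn_of_eq_add_integral zero_le_one
    (hh.mul_continuousOn (hu ▸ hχ)) (by simp [hA])
  have hA_eq : ∀ x ∈ Icc (0 : ℝ) 1, A x = ∫ r in (0 : ℝ)..x, c * φ r * A r * tauQuotient c φ r :=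
    fun x hx => integral_congr_of_ae_unitMeasure (hhA.mono fun y hy => by rw [hy]) hx
  have hA_deriv : ∀ x ∈ Icc (0 : ℝ) 1,
      HasDerivWithinAt A (c * φ x * A x * tauQuotient c φ x) (Icc 0 1) x := fun x hx =>
    (hasDerivWithinAt_integral_right_endpoint
      (((continuousOn_const.mul hφ).mul hA_cont).mul hχ) hx).congr hA_eq (hA_eq x hx)
  have hAτ_deriv : ∀ x ∈ Icc (0 : ℝ) 1,
      HasDerivWithinAt (fun x => A x * tau c φ x) 0 (Icc 0 1) x := fun x hx => by
    have hτx := hτ x hx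
    convert! (hA_deriv x hx).mul (hasDerivWithinAt_tau c hφ hx) using 1
    rw [tauQuotient]
    field_simp
    ring
  have hA_zero : ∀ x ∈ Icc (0 : ℝ) 1, A x = 0 := fun x hx => by
    have h := eq_add_integral_of_hasDerivWithinAt hAτ_deriv continuousOn_const x hx
    simpa [hA, hτ x hx] using h
  filter_upwards [hhA, ae_restrict_mem measurableSet_Icc] with x hx hxI
  rw [hx, hA_zero x hxI, mul_zero, Pi.zero_apply]

end Commutation

section EigenSystem

variable {ι : Type*}

/-- The functions `f j`, with derivatives `f' j`, form an orthonormal basis of `L²[0,1]` of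
classical Dirichlet eigenfunctions of `-d²/dx² + q`, with eigenvalues `lam j`. -/
structure IsEigenSystem (q : ℝ → ℝ) (lam : ι → ℝ) (f f' : ι → ℝ → ℝ) : Prop where
  continuousOn_potential : ContinuousOn q (Icc 0 1)
  isDirichletSolution : ∀ j, IsDirichletSolution q (lam j) (f j) (f' j)
  norm : ∀ j, ∫ x in (0 : ℝ)..1, f j x * f j x = 1
  orthogonal : Pairwise fun i j => ∫ x in (0 : ℝ)..1, f i x * f j x = 0
  complete : ∀ h : ℝ → ℝ, MemLp h 2 unitMeasure → (∀ j, ∫ x in (0 : ℝ)..1, h x * f j x = 0) →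
    h =ᵐ[unitMeasure] 0

namespace IsEigenSystem

variable {q : ℝ → ℝ} {lam : ι → ℝ} {f f' : ι → ℝ → ℝ}

theorem continuousOn (E : IsEigenSystem q lam f f') (j : ι) : ContinuousOn (f j) (Icc 0 1) :=
  (E.isDirichletSolution j).continuousOn

theorem continuousOn_deriv (E : IsEigenSystem q lam f f') (j : ι) :
    ContinuousOn (f' j) (Icc 0 1) :=
  (E.isDirichletSolution j).continuousOn_deriv

theorem memLp_top (E : IsEigenSystem q lam f f') {Q : L2} (hQ : Q =ᵐ[unitMeasure] q) :
    MemLp Q ⊤ unitMeasure :=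
  (memLp_unitMeasure_of_continuousOn E.continuousOn_potential).ae_eq hQ.symm

/-- The eigenfunctions as elements of `L²[0,1]`. -/
def vec (E : IsEigenSystem q lam f f') (j : ι) : L2 :=
  (memLp_unitMeasure_of_continuousOn (E.continuousOn j)).toLp (f j)

theorem vec_ae_eq (E : IsEigenSystem q lam f f') (j : ι) : E.vec j =ᵐ[unitMeasure] f j :=
  MemLp.coeFn_toLp _

theorem inner_vec (E : IsEigenSystem q lam f f') (j : ι) {g : L2} {h : ℝ → ℝ}
    (hg : g =ᵐ[unitMeasure] h) : inner ℝ (E.vec j) g = ∫ x in (0 : ℝ)..1, h x * f j x := by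
  rw [inner_eq_integral, ← integral_unitMeasure]
  refine integral_congr_ae ?_
  filter_upwards [E.vec_ae_eq j, hg] with x hx hgx
  rw [hx, hgx]

theorem orthonormal_vec (E : IsEigenSystem q lam f f') : Orthonormal ℝ E.vec := by
  refine ⟨fun j => ?_, fun i j hij => ?_⟩
  · rw [norm_eq_sqrt_real_inner, E.inner_vec j (E.vec_ae_eq j), E.norm, Real.sqrt_one]
  · exact (E.inner_vec i (E.vec_ae_eq j)).trans (E.orthogonal hij.symm)

/-- The eigenfunctions as a Hilbert basis of `L²[0,1]`. -/
def basis (E : IsEigenSystem q lam f f') : HilbertBasis ι ℝ L2 :=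
  HilbertBasis.mkOfOrthogonalEqBot E.orthonormal_vec <| by
    refine (Submodule.eq_bot_iff _).2 fun h hh => (Lp.eq_zero_iff_ae_eq_zero).2 ?_
    refine E.complete h (Lp.memLp h) fun j => ?_
    rw [← E.inner_vec j (ae_eq_refl _)]
    exact hh _ (Submodule.subset_span (mem_range_self j))

theorem basis_ae_eq (E : IsEigenSystem q lam f f') (j : ι) : E.basis j =ᵐ[unitMeasure] f j := by
  rw [basis, HilbertBasis.coe_mkOfOrthogonalEqBot]
  exact E.vec_ae_eq j

theorem integral_basis (E : IsEigenSystem q lam f f') (j : ι) :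
    ∫ x, E.basis j x ∂unitMeasure = ∫ x in (0 : ℝ)..1, f j x := by
  rw [← integral_unitMeasure]
  exact integral_congr_ae (E.basis_ae_eq j)

theorem schrodingerGraph_basis (E : IsEigenSystem q lam f f') {Q : L2} (hQ : Q =ᵐ[unitMeasure] q)
    (j : ι) : SchrodingerGraph Q (E.basis j) (lam j • E.basis j) :=
  (E.isDirichletSolution j).schrodingerGraph E.continuousOn_potential hQ (E.basis_ae_eq j)

theorem isospectral {q₁ q₂ : ℝ → ℝ} {f₁ f₁' f₂ f₂' : ι → ℝ → ℝ}
    (E₁ : IsEigenSystem q₁ lam f₁ f₁') (E₂ : IsEigenSystem q₂ lam f₂ f₂') {Q₁ Q₂ : L2}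
    (hQ₁ : Q₁ =ᵐ[unitMeasure] q₁) (hQ₂ : Q₂ =ᵐ[unitMeasure] q₂) : Isospectral Q₁ Q₂ :=
  isospectral_of_basis (E₁.schrodingerGraph_basis hQ₁) (E₂.schrodingerGraph_basis hQ₂)

theorem sq_integral_eq_of_isIsoheat {q₁ q₂ : ℝ → ℝ} {lam : ℕ → ℝ} {f₁ f₁' f₂ f₂' : ℕ → ℝ → ℝ}
    (E₁ : IsEigenSystem q₁ lam f₁ f₁') (E₂ : IsEigenSystem q₂ lam f₂ f₂') {Q₁ Q₂ : L2}
    (hQ₁ : Q₁ =ᵐ[unitMeasure] q₁) (hQ₂ : Q₂ =ᵐ[unitMeasure] q₂)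
    (hlam : ∀ j, 0 ≤ lam j) (hmono : StrictMono lam)
    (hexp : ∀ t : ℝ, 0 < t → Summable fun j => Real.exp (-lam j * t))
    (h : IsIsoheat Q₁ Q₂) (j : ℕ) :
    (∫ x in (0 : ℝ)..1, f₁ j x) ^ 2 = (∫ x in (0 : ℝ)..1, f₂ j x) ^ 2 := by
  rw [← E₁.integral_basis, ← E₂.integral_basis]
  exact sq_integral_basis_eq_of_isIsoheat (E₁.memLp_top hQ₁) (E₂.memLp_top hQ₂) hlam hmono hexp
    (E₁.schrodingerGraph_basis hQ₁) (E₂.schrodingerGraph_basis hQ₂) h j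

theorem isVectorFieldValue {lam : ℕ → ℝ} {f f' : ℕ → ℝ → ℝ} (E : IsEigenSystem q lam f f')
    (hlam : StrictMono lam) {Q v : L2} (hQ : Q =ᵐ[unitMeasure] q) {n : ℕ} (hpos : 0 < f' n 0)
    (hv : v =ᵐ[unitMeasure] fun x => 4 * (f n x * f' n x)) : IsVectorFieldValue (n + 1) Q v := by
  refine ⟨f n, f' n, ⟨lam n, _, isNthEigenvalue_of_strictMono hlam (E.schrodingerGraph_basis hQ) n,
    (E.isDirichletSolution n).isH2Dirichlet E.continuousOn_potential, ?_, ?_, hpos⟩, ?_⟩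
  · filter_upwards [hQ] with x hx
    rw [hx]
    ring
  · simpa only [sq] using E.norm n
  · filter_upwards [hv, ae_unitMeasure_of_forall_mem_Ioo fun x hx =>
      (((E.isDirichletSolution n).hasDerivWithinAt x (Ioo_subset_Icc_self hx)).hasDerivAt
        (Icc_mem_nhds hx.1 hx.2)).pow 2] with x hvx hderiv
    rw [hvx]
    refine Eq.trans ?_ (congrArg (2 * ·) hderiv.deriv.symm)
    push_cast
    ring

end IsEigenSystem

section Commutation

variable {q : ℝ → ℝ} {lam : ι → ℝ} {f f' : ι → ℝ → ℝ} {c : ℝ} {n : ι}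

namespace IsEigenSystem

theorem tau_pos (E : IsEigenSystem q lam f f') (hc : -1 < c) {x : ℝ} (hx : x ∈ Icc (0 : ℝ) 1) :
    0 < tau c (f n) x :=
  Isoheat.tau_pos (E.continuousOn n) (E.norm n) hc hx

theorem tau_zero (E : IsEigenSystem q lam f f') : tau c (f n) 0 = 1 + c := by
  rw [tau, tailInner, E.norm, mul_one]

theorem ae_eq_zero_of_integral_mul_commutation_eq_zero (E : IsEigenSystem q lam f f')
    (hc : -1 < c) {h : ℝ → ℝ} (hh : MemLp h 2 unitMeasure)
    (horth : ∀ j, ∫ x in (0 : ℝ)..1, h x * commutation c (f n) (f j) x = 0) :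
    h =ᵐ[unitMeasure] 0 := by
  have hτ : ∀ x ∈ Icc (0 : ℝ) 1, tau c (f n) x ≠ 0 := fun x hx => (E.tau_pos hc hx).ne'
  have hh_int := intervalIntegrable_of_memLp_unitMeasure hh
  have hχ_int : IntervalIntegrable (fun r => h r * tauQuotient c (f n) r) volume 0 1 :=
    hh_int.mul_continuousOn
      ((uIcc_of_le (zero_le_one' ℝ)).symm ▸ continuousOn_tauQuotient (E.continuousOn n) hτ)
  have hA_cont : ContinuousOn (fun x => ∫ r in (0 : ℝ)..x, h r * tauQuotient c (f n) r)
      (Icc 0 1) := continuousOn_of_eq_add_integral zero_le_one hχ_int (by simp)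
  refine ae_eq_zero_of_ae_eq_mul_integral_tauQuotient (c := c) (E.continuousOn n) hτ hh_int ?_
  have h_sub := E.complete _ (hh.sub (memLp_unitMeasure_of_continuousOn
    ((continuousOn_const (c := c).mul (E.continuousOn n)).mul hA_cont))) fun j =>
      (integral_mul_commutation hh_int (E.continuousOn n) (E.continuousOn j) hτ).symm.trans
        (horth j)
  filter_upwards [h_sub] with x hx
  exact sub_eq_zero.1 hx

end IsEigenSystem

variable [DecidableEq ι]

/-- The factor normalizing the double commutation `commutation c (f n) (f j)` in `L²[0,1]`. -/
def commutationWeight (c : ℝ) (n j : ι) : ℝ := if j = n then √(1 + c) else 1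

theorem commutationWeight_self (c : ℝ) (n : ι) : commutationWeight c n n = √(1 + c) := if_pos rfl

theorem commutationWeight_of_ne (c : ℝ) {j : ι} (h : j ≠ n) : commutationWeight c n j = 1 :=
  if_neg h

theorem commutationWeight_pos (hc : -1 < c) (n j : ι) : 0 < commutationWeight c n j := by
  have : 0 < 1 + c := by linarith
  unfold commutationWeight
  split_ifs <;> positivity

namespace IsEigenSystem

theorem integral_commutationWeight_mul_commutation (E : IsEigenSystem q lam f f') (hc : -1 < c)
    (i j : ι) :
    ∫ x in (0 : ℝ)..1, commutationWeight c n i * commutation c (f n) (f i) x *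
        (commutationWeight c n j * commutation c (f n) (f j) x) =
      commutationWeight c n i * commutationWeight c n j *
        ((∫ x in (0 : ℝ)..1, f i x * f j x) - c * ((∫ x in (0 : ℝ)..1, f n x * f i x) *
          (∫ x in (0 : ℝ)..1, f n x * f j x) / (1 + c))) := by
  rw [← E.tau_zero (n := n), ← integral_commutation_mul_commutation (E.continuousOn n)
    (E.continuousOn i) (E.continuousOn j) fun x hx => (E.tau_pos hc hx).ne',
    ← intervalIntegral.integral_const_mul]
  congr 1
  funext x
  ring

theorem commutation (E : IsEigenSystem q lam f f') (hc : -1 < c) (n : ι) :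
    IsEigenSystem (commutedPotential q c (f n) (f' n)) lam
      (fun j x => commutationWeight c n j * commutation c (f n) (f j) x)
      (fun j x => commutationWeight c n j * commutationDeriv c (f n) (f' n) (f j) (f' j) x) where
  continuousOn_potential := continuousOn_commutedPotential E.continuousOn_potential
    (E.continuousOn n) (E.continuousOn_deriv n) fun x hx => (E.tau_pos hc hx).ne'
  isDirichletSolution j := ((E.isDirichletSolution n).commutation (E.isDirichletSolution j)
    fun x hx => (E.tau_pos hc hx).ne').const_mul _
  norm j := by
    have hc' : 0 < 1 + c := by linarith
    rw [E.integral_commutationWeight_mul_commutation hc, E.norm]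
    rcases eq_or_ne j n with rfl | hj
    · rw [E.norm, commutationWeight_self, Real.mul_self_sqrt hc'.le]
      field_simp
      ring
    · simp [commutationWeight_of_ne c hj, E.orthogonal hj.symm]
  orthogonal i j hij := by
    have zero_or_zero : (∫ x in (0 : ℝ)..1, f n x * f i x) = 0 ∨
        (∫ x in (0 : ℝ)..1, f n x * f j x) = 0 := by
      rcases eq_or_ne n i with rfl | hi
      · exact .inr (E.orthogonal hij)
      · exact .inl (E.orthogonal hi)
    have h_orthogonal : ∫ x in (0 : ℝ)..1, f i x * f j x = 0 := E.orthogonal hij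
    refine (E.integral_commutationWeight_mul_commutation hc i j).trans ?_
    rw [h_orthogonal, mul_eq_zero.2 zero_or_zero, zero_div, mul_zero, sub_zero, mul_zero]
  complete h hh horth := by
    refine E.ae_eq_zero_of_integral_mul_commutation_eq_zero (n := n) hc hh fun j => ?_
    have weighted := horth j
    simp only [mul_left_comm (h _), intervalIntegral.integral_const_mul] at weighted
    exact (mul_eq_zero.1 weighted).resolve_left (commutationWeight_pos hc n j).ne'

end IsEigenSystem

end Commutation

end EigenSystem

section Flow

theorem hasDerivAt_Lp_of_tendstoUniformlyOn {α E : Type*} [MeasurableSpace α] {μ : Measure α}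
    [IsFiniteMeasure μ] [NormedAddCommGroup E] [NormedSpace ℝ E] {p : ENNReal} [Fact (1 ≤ p)]
    {S : Set α} (hS : ∀ᵐ x ∂μ, x ∈ S) {Γ Γ' : ℝ → α → E} {γ : ℝ → Lp E p μ} {v : Lp E p μ} {s : ℝ}
    (hγ : ∀ r, γ r =ᵐ[μ] Γ r) (hv : v =ᵐ[μ] Γ' s)
    (hderiv : ∀ x ∈ S, ∀ r, HasDerivAt (fun r => Γ r x) (Γ' r x) r)
    (hunif : TendstoUniformlyOn Γ' (Γ' s) (𝓝 s) S) : HasDerivAt γ v s := by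
  rw [hasDerivAt_iff_isLittleO, Asymptotics.isLittleO_iff]
  intro ε hε
  set K : ℝ := measureUnivNNReal μ ^ p.toReal⁻¹
  have : 0 ≤ K := by positivity
  set η := ε / (K + 1)
  obtain ⟨δ, hδ, hball⟩ := Metric.eventually_nhds_iff_ball.1
    (Metric.tendstoUniformlyOn_iff.1 hunif η (by positivity))
  filter_upwards [Metric.ball_mem_nhds s hδ] with s' hs'
  have pointwise : ∀ x ∈ S, ‖Γ s' x - Γ s x - (s' - s) • Γ' s x‖ ≤ η * ‖s' - s‖ := fun x hx => by
    have mean_value := (convex_ball s δ).norm_image_sub_le_of_norm_hasDerivWithin_le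
      (fun r _ => ((hderiv x hx r).sub ((hasDerivAt_id r).smul_const (Γ' s x))).hasDerivWithinAt)
      (fun r hr => by
        rw [one_smul, ← dist_eq_norm, dist_comm]
        exact (hball r hr x hx).le) (Metric.mem_ball_self hδ) hs'
    convert! mean_value using 2
    simp only [Pi.sub_apply, id_eq, sub_smul]
    abel
  have ae_bound : ∀ᵐ x ∂μ, ‖(γ s' - γ s - (s' - s) • v : Lp E p μ) x‖ ≤ η * ‖s' - s‖ := by
    filter_upwards [Lp.coeFn_sub (γ s' - γ s) ((s' - s) • v), Lp.coeFn_sub (γ s') (γ s),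
      Lp.coeFn_smul (s' - s) v, hγ s', hγ s, hv, hS] with x h₁ h₂ h₃ h₄ h₅ h₆ hx
    rw [h₁, Pi.sub_apply, h₂, Pi.sub_apply, h₃, Pi.smul_apply, h₄, h₅, h₆]
    exact pointwise x hx
  calc ‖γ s' - γ s - (s' - s) • v‖ ≤ K * (η * ‖s' - s‖) :=
        Lp.norm_le_of_ae_bound (by positivity) ae_bound
    _ = K / (K + 1) * (ε * ‖s' - s‖) := by ring
    _ ≤ ε * ‖s' - s‖ := mul_le_of_le_one_left (by positivity)
        ((div_le_one (by positivity)).2 (by linarith))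

theorem hasDerivAt_commutedPotential {c : ℝ} {q φ φ' : ℝ → ℝ} {x : ℝ} (hτ : tau c φ x ≠ 0) :
    HasDerivAt (fun c => commutedPotential q c φ φ' x)
      (4 * (tauQuotient c φ x * tauQuotientDeriv c φ φ' x)) c := by
  have hτ' : HasDerivAt (fun c => tau c φ x) (tailInner φ φ x) c := by
    convert! ((hasDerivAt_id' c).mul_const (tailInner φ φ x)).const_add 1 using 1
    rw [one_mul]
  have hχ := (hasDerivAt_const c (φ x)).div hτ' hτ
  have hχ' := ((hasDerivAt_const c (φ' x)).div hτ' hτ).add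
    (((hasDerivAt_id c).mul_const (φ x ^ 3)).div (hτ'.pow 2) (pow_ne_zero 2 hτ))
  have h := (((hasDerivAt_id c).const_mul 2).mul
    ((hχ.const_mul (φ' x)).add (hχ'.const_mul (φ x)))).const_add (q x)
  convert! h using 1
  simp only [Pi.pow_apply, Pi.add_apply, Pi.div_apply, id_eq, tauQuotient, tauQuotientDeriv]
  field_simp
  rw [tau]
  ring

theorem continuousOn_uncurry_tauQuotient_mul_tauQuotientDeriv {φ φ' : ℝ → ℝ} {U : Set ℝ}
    (hφ : ContinuousOn φ (Icc 0 1)) (hφ' : ContinuousOn φ' (Icc 0 1))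
    (hτ : ∀ c ∈ U, ∀ x ∈ Icc (0 : ℝ) 1, tau c φ x ≠ 0) :
    ContinuousOn (fun p : ℝ × ℝ => tauQuotient p.1 φ p.2 * tauQuotientDeriv p.1 φ φ' p.2)
      (U ×ˢ Icc 0 1) := by
  have comp_snd : ∀ {g : ℝ → ℝ}, ContinuousOn g (Icc 0 1) →
      ContinuousOn (fun p : ℝ × ℝ => g p.2) (U ×ˢ Icc 0 1) := fun hg =>
    hg.comp continuousOn_snd fun p hp => hp.2
  have hτ_cont : ContinuousOn (fun p : ℝ × ℝ => tau p.1 φ p.2) (U ×ˢ Icc 0 1) :=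
    continuousOn_const.add (continuousOn_fst.mul (comp_snd (continuousOn_tailInner hφ hφ)))
  have hτ' : ∀ p ∈ U ×ˢ Icc (0 : ℝ) 1, tau p.1 φ p.2 ≠ 0 := fun p hp => hτ p.1 hp.1 p.2 hp.2
  exact ((comp_snd hφ).div hτ_cont hτ').mul (((comp_snd hφ').div hτ_cont hτ').add
    ((continuousOn_fst.mul ((comp_snd hφ).pow 3)).div (hτ_cont.pow 2)
      fun p hp => pow_ne_zero 2 (hτ' p hp)))

variable {q : ℝ → ℝ} {lam : ℕ → ℝ} {f f' : ℕ → ℝ → ℝ} {n : ℕ}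

/-- The velocity of `s ↦ commutedPotential q (exp s - 1) φ φ'`, when `φ'` is the derivative
of `φ`. -/
def commutedVelocity (φ φ' : ℝ → ℝ) (s x : ℝ) : ℝ :=
  4 * (tauQuotient (Real.exp s - 1) φ x * tauQuotientDeriv (Real.exp s - 1) φ φ' x) * Real.exp s

theorem neg_one_lt_exp_sub_one (s : ℝ) : -1 < Real.exp s - 1 := by linarith [Real.exp_pos s]

namespace IsEigenSystem

theorem continuousOn_uncurry_commutedVelocity (E : IsEigenSystem q lam f f') :
    ContinuousOn (Function.uncurry (commutedVelocity (f n) (f' n))) (univ ×ˢ Icc 0 1) :=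
  (continuousOn_const.mul ((continuousOn_uncurry_tauQuotient_mul_tauQuotientDeriv
    (U := Ioi (-1)) (E.continuousOn n) (E.continuousOn_deriv n)
    fun _ hc _ hx => (E.tau_pos hc hx).ne').comp
      (f := fun p : ℝ × ℝ => (Real.exp p.1 - 1, p.2)) (by fun_prop)
      fun p hp => ⟨neg_one_lt_exp_sub_one p.1, hp.2⟩)).mul (by fun_prop)

theorem hasDerivAt_commutedPotential (E : IsEigenSystem q lam f f') {γ : ℝ → L2}
    (hγ : ∀ s, γ s =ᵐ[unitMeasure] commutedPotential q (Real.exp s - 1) (f n) (f' n)) {s : ℝ}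
    {v : L2} (hv : v =ᵐ[unitMeasure] commutedVelocity (f n) (f' n) s) : HasDerivAt γ v s := by
  refine hasDerivAt_Lp_of_tendstoUniformlyOn (ae_restrict_mem measurableSet_Icc) hγ hv
    (fun x hx r => ?_) fun u hu => ?_
  · exact HasDerivAt.comp r (h₂ := fun c => commutedPotential q c (f n) (f' n) x)
      (Isoheat.hasDerivAt_commutedPotential (E.tau_pos (neg_one_lt_exp_sub_one r) hx).ne')
      ((Real.hasDerivAt_exp r).sub_const 1)
  · obtain ⟨t, ht, h⟩ := isCompact_Icc.mem_uniformity_of_prod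
      E.continuousOn_uncurry_commutedVelocity (mem_univ s) (symm_le_uniformity hu)
    filter_upwards [nhdsWithin_univ s ▸ ht] with r hr x hx using h r hr x hx

theorem isFlowLine (E : IsEigenSystem q lam f f') (hlam : StrictMono lam) (hpos : 0 < f' n 0)
    {γ : ℝ → L2}
    (hγ : ∀ s, γ s =ᵐ[unitMeasure] commutedPotential q (Real.exp s - 1) (f n) (f' n)) :
    IsFlowLine (n + 1) (γ 0) γ := by
  refine ⟨rfl, fun s => ?_⟩
  have hc := neg_one_lt_exp_sub_one s
  have h_zero : (0 : ℝ) ∈ Icc (0 : ℝ) 1 := left_mem_Icc.2 zero_le_one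
  have hL : MemLp (commutedVelocity (f n) (f' n) s) 2 unitMeasure :=
    memLp_unitMeasure_of_continuousOn (E.continuousOn_uncurry_commutedVelocity.comp
      (continuousOn_const.prodMk continuousOn_id) fun x hx => ⟨mem_univ s, hx⟩)
  refine ⟨hL.toLp, (E.commutation hc n).isVectorFieldValue hlam (hγ s) ?_ ?_,
    E.hasDerivAt_commutedPotential hγ hL.coeFn_toLp⟩
  · have hτ := E.tau_pos (n := n) hc h_zero
    refine mul_pos (commutationWeight_pos hc n n) ?_
    rw [commutationDeriv_self hτ.ne', tauQuotientDeriv, (E.isDirichletSolution n).left]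
    simpa using div_pos hpos hτ
  · filter_upwards [hL.coeFn_toLp, ae_restrict_mem measurableSet_Icc] with x hvx hx
    have hτ := (E.tau_pos (n := n) hc hx).ne'
    have weight_sq : commutationWeight (Real.exp s - 1) n n ^ 2 = Real.exp s := by
      rw [commutationWeight_self, add_sub_cancel, Real.sq_sqrt (Real.exp_pos s).le]
    rw [hvx, commutation_self hτ, commutationDeriv_self hτ, commutedVelocity]
    linear_combination -4 * (tauQuotient (Real.exp s - 1) (f n) x *
      tauQuotientDeriv (Real.exp s - 1) (f n) (f' n) x) * weight_sq

end IsEigenSystem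

end Flow

section SineSystem

open Real

theorem strictMono_sineEigenvalue : StrictMono sineEigenvalue := fun i j hij => by
  unfold sineEigenvalue
  gcongr

theorem summable_exp_neg_sineEigenvalue_mul {t : ℝ} (ht : 0 < t) :
    Summable fun j => exp (-sineEigenvalue j * t) := by
  refine (summable_exp_nat_mul_of_ge (neg_lt_zero.2 ht) (f := sineEigenvalue) fun j => ?_).congr
    fun j => by ring_nf
  have le_sq : (j : ℝ) ≤ (j : ℝ) ^ 2 := by exact_mod_cast Nat.le_self_pow two_ne_zero j
  rw [sineEigenvalue, mul_pow]
  exact le_sq.trans (le_mul_of_one_le_right (sq_nonneg _)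
    (one_le_pow₀ (one_le_two.trans two_le_pi)))

theorem integral_sine_mul_sine {i j : ℕ} (hij : i ≠ j) :
    ∫ x in (0 : ℝ)..1, sine i x * sine j x = 0 := by
  have comm := (isH2Dirichlet_sine i).integral_snd_mul_comm (isH2Dirichlet_sine j)
  simp only [mul_assoc, mul_left_comm (sine i _), intervalIntegral.integral_const_mul] at comm
  refine (mul_eq_mul_right_iff.1 comm).resolve_left fun h => ?_
  exact hij (strictMono_sineEigenvalue.injective (neg_injective h))

theorem sine_mul_self (k : ℕ) (x : ℝ) : sine k x * sine k x = 2 * sin (k * π * x) ^ 2 := by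
  rw [sine, mul_mul_mul_comm, mul_self_sqrt zero_le_two, sq]

theorem integral_sine_mul_self {k : ℕ} (hk : k ≠ 0) :
    ∫ x in (0 : ℝ)..1, sine k x * sine k x = 1 := by
  have hkπ : (k * π : ℝ) ≠ 0 := by positivity
  simp only [sine_mul_self]
  rw [intervalIntegral.integral_const_mul,
    intervalIntegral.integral_comp_mul_left (fun y => sin y ^ 2) hkπ, integral_sin_sq]
  simp only [mul_zero, mul_one, sin_zero, sin_nat_mul_pi, zero_mul, smul_eq_mul]
  field_simp
  ring

theorem isEigenSystem_sine : IsEigenSystem 0 (fun j => sineEigenvalue (j + 1))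
    (fun j => sine (j + 1)) (fun j => sineDeriv (j + 1)) where
  continuousOn_potential := continuousOn_const
  isDirichletSolution j := isDirichletSolution_sine (j + 1)
  norm j := integral_sine_mul_self j.succ_ne_zero
  orthogonal i j hij := integral_sine_mul_sine fun h => hij (Nat.succ_injective h)
  complete h hh horth := by
    refine ae_eq_zero_of_integral_mul_sine_eq_zero (intervalIntegrable_of_memLp_unitMeasure hh) ?_
    rintro (_ | k)
    · simp [sine]
    · exact horth k

end SineSystem

section GammaFlow

open Real

theorem theta_eq_tau (n : ℕ) (s : ℝ) : theta n s = tau (exp s - 1) (sine n) := by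
  funext x
  simp only [theta, tau, tailInner, sine_mul_self]

theorem gammaFlow_ae_eq (n : ℕ) (s : ℝ) : gammaFlow n s =ᵐ[unitMeasure]
    commutedPotential 0 (exp s - 1) (sine n) (sineDeriv n) := by
  filter_upwards [MemLp.coeFn_toLp (memLp_gammaFun n s), ae_unitMeasure_of_forall_mem_Ioo
    fun x hx => commutedPotential_eq_sub_iteratedDeriv (q := 0)
      (isDirichletSolution_sine n).hasDerivWithinAt
      (fun y hy => theta_eq_tau n s ▸ (theta_pos n s hy).ne') hx] with x hγ hq
  rw [gammaFlow, hγ, hq, gammaFun, theta_eq_tau, Pi.zero_apply, zero_sub, neg_mul]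

theorem gammaFlow_zero (n : ℕ) : gammaFlow n 0 = 0 := by
  rw [Lp.eq_zero_iff_ae_eq_zero]
  filter_upwards [gammaFlow_ae_eq n 0] with x hx
  simp [hx, commutedPotential]

theorem isFlowLine_gammaFlow {n : ℕ} (hn : 1 ≤ n) : IsFlowLine n 0 (gammaFlow n) := by
  obtain ⟨m, rfl⟩ := Nat.exists_eq_add_of_le' hn
  rw [← gammaFlow_zero (m + 1)]
  refine isEigenSystem_sine.isFlowLine (strictMono_sineEigenvalue.comp (strictMono_id.add_const 1))
    ?_ (gammaFlow_ae_eq (m + 1))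
  simp only [sineDeriv, mul_zero, cos_zero, mul_one]
  positivity

theorem isospectral_gammaFlow {n : ℕ} (hn : 1 ≤ n) (s : ℝ) : Isospectral (gammaFlow n s) 0 := by
  obtain ⟨m, rfl⟩ := Nat.exists_eq_add_of_le' hn
  exact (isEigenSystem_sine.commutation (neg_one_lt_exp_sub_one s) m).isospectral
    isEigenSystem_sine (gammaFlow_ae_eq (m + 1) s) (Lp.coeFn_zero ℝ 2 unitMeasure)

theorem tailInner_sine_two_mul {n : ℕ} (hn : n ≠ 0) (x : ℝ) :
    tailInner (sine n) (sine (2 * n)) x = -(4 / (3 * (n * π)) * sin (n * π * x) ^ 3) := by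
  have : (n * π : ℝ) ≠ 0 := by positivity
  have primitive (y : ℝ) : HasDerivAt (fun y => 4 / (3 * (n * π)) * sin (n * π * y) ^ 3)
      (sine n y * sine (2 * n) y) y := by
    have double_angle : sine (2 * n) y = √2 * (2 * sin (n * π * y) * cos (n * π * y)) := by
      rw [sine, ← sin_two_mul]
      push_cast
      ring_nf
    convert! ((((hasDerivAt_id y).const_mul (n * π)).sin).pow 3).const_mul
      (4 / (3 * (n * π))) using 1
    rw [double_angle, sine]
    simp only [id_eq]
    field_simp
    rw [sq_sqrt zero_le_two]
    push_cast
    ring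
  rw [tailInner, intervalIntegral.integral_eq_sub_of_hasDerivAt (fun y _ => primitive y)
    (((continuous_sine n).mul (continuous_sine (2 * n))).intervalIntegrable _ _),
    mul_one, sin_nat_mul_pi]
  ring

theorem integral_sine_two_mul (n : ℕ) : ∫ x in (0 : ℝ)..1, sine (2 * n) x = 0 := by
  rcases eq_or_ne n 0 with rfl | hn
  · simp [sine]
  have ftc := intervalIntegral.integral_eq_sub_of_hasDerivAt
    (fun x (_ : x ∈ uIcc 0 1) => hasDerivAt_sineDeriv (2 * n) x)
    ((continuous_const.mul (continuous_sine (2 * n))).intervalIntegrable _ _)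
  have cos_eq_one : cos ((2 * n : ℕ) * π) = 1 := by
    rw [← cos_nat_mul_two_pi n]
    push_cast
    ring_nf
  rw [intervalIntegral.integral_const_mul, sineDeriv, sineDeriv, mul_one, cos_eq_one, mul_zero,
    cos_zero, sub_self] at ftc
  refine (mul_eq_zero.1 ftc).resolve_left (neg_ne_zero.2 ?_)
  rw [sineEigenvalue]
  positivity

theorem integral_commutation_sine_two_mul {n : ℕ} {c : ℝ} (hn : n ≠ 0)
    (hτ : ∀ x ∈ Icc (0 : ℝ) 1, tau c (sine n) x ≠ 0) :
    ∫ x in (0 : ℝ)..1, commutation c (sine n) (sine (2 * n)) x = c * (4 * √2 / (3 * (n * π)) *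
      ∫ x in (0 : ℝ)..1, sin (n * π * x) ^ 4 / tau c (sine n) x) := by
  have hu : uIcc (0 : ℝ) 1 = Icc 0 1 := uIcc_of_le zero_le_one
  have hn_cont := (continuous_sine n).continuousOn (s := Icc 0 1)
  have hn₂_cont := (continuous_sine (2 * n)).continuousOn (s := Icc 0 1)
  simp only [commutation]
  rw [intervalIntegral.integral_sub ((continuous_sine _).intervalIntegrable _ _)
      (ContinuousOn.intervalIntegrable <| hu ▸ continuousOn_const.mul
        ((continuousOn_tauQuotient hn_cont hτ).mul (continuousOn_tailInner hn_cont hn₂_cont))),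
    integral_sine_two_mul, zero_sub, ← intervalIntegral.integral_neg,
    ← intervalIntegral.integral_const_mul, ← intervalIntegral.integral_const_mul]
  congr 1
  funext x
  rw [tailInner_sine_two_mul hn, tauQuotient, sine]
  ring

theorem integral_commutation_sine_two_mul_ne_zero {n : ℕ} {c : ℝ} (hn : n ≠ 0)
    (hc : c ≠ 0) (hτ : ∀ x ∈ Icc (0 : ℝ) 1, 0 < tau c (sine n) x) :
    ∫ x in (0 : ℝ)..1, commutation c (sine n) (sine (2 * n)) x ≠ 0 := by
  rw [integral_commutation_sine_two_mul hn fun x hx => (hτ x hx).ne']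
  refine mul_ne_zero hc (mul_pos (by positivity) ?_).ne'
  have hn_one : (1 : ℝ) ≤ n := by exact_mod_cast Nat.one_le_iff_ne_zero.2 hn
  have quarter_wave : (1 / (2 * n) : ℝ) ∈ Icc (0 : ℝ) 1 :=
    ⟨by positivity, (div_le_one (by positivity)).2 (by linarith)⟩
  refine intervalIntegral.integral_pos zero_lt_one ?_ (fun x hx => ?_)
    ⟨_, quarter_wave, div_pos ?_ (hτ _ quarter_wave)⟩
  · exact ContinuousOn.div (by fun_prop) (continuousOn_tau (continuous_sine n).continuousOn)
      fun x hx => (hτ x hx).ne'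
  · have := hτ x (Ioc_subset_Icc_self hx)
    positivity
  · rw [show n * π * (1 / (2 * n)) = π / 2 by field_simp, sin_pi_div_two]
    positivity

theorem not_isIsoheat_gammaFlow {n : ℕ} (hn : 1 ≤ n) {s : ℝ} (hs : s ≠ 0) :
    ¬ IsIsoheat (gammaFlow n s) 0 := by
  intro h
  obtain ⟨m, rfl⟩ := Nat.exists_eq_add_of_le' hn
  have hc := neg_one_lt_exp_sub_one s
  have sq_eq := (isEigenSystem_sine.commutation hc m).sq_integral_eq_of_isIsoheat
    isEigenSystem_sine (gammaFlow_ae_eq (m + 1) s) (Lp.coeFn_zero ℝ 2 unitMeasure)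
    (fun j => sq_nonneg _) (strictMono_sineEigenvalue.comp (strictMono_id.add_const 1))
    (fun t ht => (summable_nat_add_iff 1).2 (summable_exp_neg_sineEigenvalue_mul ht)) h (2 * m + 1)
  simp only [commutationWeight_of_ne _ (by omega : 2 * m + 1 ≠ m), one_mul] at sq_eq
  refine integral_commutation_sine_two_mul_ne_zero m.succ_ne_zero
    (sub_ne_zero.2 ((exp_eq_one_iff s).not.2 hs)) (fun x hx => isEigenSystem_sine.tau_pos hc hx) ?_
  exact sq_eq_zero_iff.1 (sq_eq.trans ((sq_eq_zero_iff).2 (integral_sine_two_mul (m + 1))))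

end GammaFlow

end Isoheat

end

theorem theorem2_general (n : ℕ) (hn : 1 ≤ n) :
    Isoheat.IsFlowLine n 0 (Isoheat.gammaFlow n) ∧
    (∀ s : ℝ, Isoheat.Isospectral (Isoheat.gammaFlow n s) 0) ∧
    ∀ s : ℝ, s ≠ 0 → ¬ Isoheat.IsIsoheat (Isoheat.gammaFlow n s) 0 :=
  ⟨Isoheat.isFlowLine_gammaFlow hn, Isoheat.isospectral_gammaFlow hn,
    fun _ hs => Isoheat.not_isIsoheat_gammaFlow hn hs⟩

theorem theorem2 (n : ℕ) (hn : 1 ≤ n) :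
    Isoheat.IsFlowLine n 0 (Isoheat.gammaFlow n) ∧
    (∀ s : ℝ, Isoheat.Isospectral (Isoheat.gammaFlow n s) 0) ∧
    ¬ Isoheat.IsIsoheatDeformation (Isoheat.gammaFlow n) ∧
    ∃ ε : ℝ, 0 < ε ∧ ∀ s : ℝ, s ≠ 0 → |s| < ε →
      ¬ Isoheat.IsIsoheat (Isoheat.gammaFlow n s) 0 := by
  obtain ⟨flow, isospectral, not_isoheat⟩ := theorem2_general n hn
  exact ⟨flow, isospectral, fun h => not_isoheat 1 one_ne_zero (flow.1 ▸ h 1 0),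
    1, one_pos, fun s hs _ => not_isoheat s hs⟩
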